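/- Call a symmetric monoidal groupoid $(\mathcal A,+,0,\beta)$ in which every object is invertible up to isomorphism a Picard groupoid, and call it strictly commutative if $\beta_{a,a}=\mathrm{id}_{a+a}$ for every object $a$. Let $X_\bullet$ be a simplicial set, $i\colon Y_\bullet\subset X_\bullet$ a simplicial subset, and $\mathcal A$ a strictly commutative Picard groupoid. For $\mathcal B=\mathcal A$ or $\mathcal B=\mathbb Z[0]$ (the integers as a discrete Picard groupoid), let $C^\bullet(X;\mathcal B)$ be the complex of Picard groupoids of $\mathcal B$-valued functions on the sets $X_n$, let $C_\bullet(X;\mathcal B)$ be the complex of finitely supported ones, both with the alternating sums of the face maps as differentials $d$ and the canonical isomorphisms $\chi\colon dd\Rightarrow 0$, and let $C_\bullet(X,Y;\mathcal B)$ be the cokernel of $C_\bullet(Y;\mathcal B)\to C_\bullet(X;\mathcal B)$ in Picard groupoids. The (co)homology of such a complex is the Picard groupoid whose objects are the pairs $(a,\varphi)$ with $\varphi\colon da\to0$ and $d\varphi=\chi_a$, and whose morphisms $(a,\varphi)\to(a',\varphi')$ are the classes of pairs $(b,f)$ with $f\colon(a,\varphi)\to(db+a',\chi_b+\varphi')$,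 where $(b,f)\sim(b',f')$ if there are $c$ and $g\colon b\to dc+b'$ such that $f'$ is the composite of $f$ with $dg$ and $\chi_c$. Let $$\cap\colon H_p(X,Y;\mathbb Z[0])\otimes H^q(X;\mathcal A)\to H_{p-q}(X,Y;\mathcal A)$$ be the homomorphism of Picard groupoids induced by the map which sends a $p$-simplex $\sigma$ and a $q$-cochain $\alpha$ to $(-1)^{pq+q(q+1)/2}\,\alpha(\sigma_{0\dots q})\,\sigma_{q\dots p}$, where $\sigma_{0\dots q}$ and $\sigma_{q\dots p}$ are the front $q$-face and the back $(p-q)$-face of $\sigma$; for $Y=\emptyset$ this is the absolute cap product. A homomorphism out of a tensor product $\mathcal P\otimes\mathcal Q$ of Picard groupoids is the same as a functor of two variables that is additive in each of them, up to coherent natural isomorphism. Let $\partial$ denote the connecting homomorphisms of the pair $(X,Y)$. Then for all integers $p,q$ with $p-1\ge q\ge0$ the square $$\begin{array}{ccc}H_p(X,Y;\mathbb Z[0])\otimes H^q(X;\mathcal A)&\xrightarrow{\ \cap\ }&H_{p-q}(X,Y;\mathcal A)\\ {\scriptstyle\partial\otimes i^*}\downarrow&&\downarrow{\scriptstyle\partial}\\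 H_{p-1}(Y;\mathbb Z[0])\otimes H^q(Y;\mathcal A)&\xrightarrow{\ \cap\ }&H_{p-q-1}(Y;\mathcal A)\end{array}$$ commutes up to a natural isomorphism: there are isomorphisms $\partial(z\cap F)\cong(\partial z)\cap(i^*F)$ that are natural in $z$ and in $F$ and compatible with the addition in each of the two variables. -/

import Mathlib

open CategoryTheory MonoidalCategory
open Simplicial Opposite

universe w w' v u

noncomputable section

namespace PicCoh

set_option linter.unusedSectionVars false

/-- Strictly commutative Picard groupoids: symmetric monoidal groupoids in which every object is
invertible and the symmetry of every object with itself is the identity. -/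
class IsStrictPicard (A : Type u) [Category.{v} A] [MonoidalCategory A] [SymmetricCategory A] : Prop
    extends IsGroupoid A where
  exists_inverse : ∀ a : A, ∃ b : A, Nonempty (a ⊗ b ≅ 𝟙_ A)
  braiding_self : ∀ a : A, (β_ a a).hom = 𝟙 _

section LC
variable {T : Type w} [TopologicalSpace T] {A : Type u} [Category.{v} A]

/-- A family of morphisms of `A` is locally constant in its parameter. -/
def LC {a b : T → A} (f : ∀ x, a x ⟶ b x) : Prop :=
  IsLocallyConstant fun x => Arrow.mk (f x)

theorem LC.comp {a b c : T → A} {f : ∀ x, a x ⟶ b x} {g : ∀ x, b x ⟶ c x} (hf : LC f) (hg : LC g) :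
    LC fun x => f x ≫ g x := by
  refine (IsLocallyConstant.iff_eventually_eq _).2 fun x => ?_
  filter_upwards [IsLocallyConstant.eventually_eq hf x, IsLocallyConstant.eventually_eq hg x]
    with y h1 h2
  have e1 : a y = a x := congrArg (fun t : Arrow A => t.left) h1
  have e2 : b y = b x := congrArg (fun t : Arrow A => t.right) h1
  have e3 : c y = c x := congrArg (fun t : Arrow A => t.right) h2
  generalize f y = fy at *
  generalize g y = gy at *
  generalize a y = ay at *
  generalize b y = by' at *
  generalize c y = cy at *
  subst e1 e2 e3
  rw [Arrow.mk_injective _ _ h1, Arrow.mk_injective _ _ h2]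

theorem LC.inv [IsGroupoid A] {a b : T → A} {f : ∀ x, a x ⟶ b x} (hf : LC f) :
    LC fun x => inv (f x) :=
  IsLocallyConstant.comp hf (fun u => Arrow.mk (CategoryTheory.inv u.hom))

theorem LC.tensor [MonoidalCategory A] {a b c d : T → A} {f : ∀ x, a x ⟶ b x}
    {g : ∀ x, c x ⟶ d x} (hf : LC f) (hg : LC g) : LC fun x => f x ⊗ₘ g x :=
  IsLocallyConstant.comp₂ hf hg (fun u v => Arrow.mk (u.hom ⊗ₘ v.hom))

/-- precomposition with a continuous map -/
theorem LC.pre {S : Type w'} [TopologicalSpace S] {a b : T → A} {f : ∀ x, a x ⟶ b x} (hf : LC f)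
    {φ : S → T} (hφ : Continuous φ) : LC fun y => f (φ y) :=
  IsLocallyConstant.comp_continuous hf hφ

end LC

/-- A continuous symmetric monoidal functor from the abelian group `M`, regarded as a discrete
Picard groupoid, to `A`: objects `F(x)` with structure isomorphisms `F(x) + F(y) ⟶ F(x + y)` that
are associative and symmetric, all of this locally constant in the group variables.  (Structure
morphisms are indexed by a proof of `x + y = z` to avoid transports.) -/
structure AddFun (M : Type w) [AddCommGroup M] [TopologicalSpace M]
    (A : Type u) [Category.{v} A] [MonoidalCategory A] [SymmetricCategory A] where
  obj : M → A
  unit : ∀ {x : M}, x = 0 → (𝟙_ A ⟶ obj x)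
  add : ∀ {x y z : M}, x + y = z → (obj x ⊗ obj y ⟶ obj z)
  unit_add : ∀ {o x : M} (h : o = 0) (h' : o + x = x),
    (unit h ▷ obj x) ≫ add h' = (λ_ (obj x)).hom
  add_assoc : ∀ {x y z xy yz t : M} (h₁ : x + y = xy) (h₂ : xy + z = t) (h₃ : y + z = yz)
    (h₄ : x + yz = t),
    (add h₁ ▷ obj z) ≫ add h₂ = (α_ (obj x) (obj y) (obj z)).hom ≫ (obj x ◁ add h₃) ≫ add h₄
  add_comm : ∀ {x y z : M} (h : x + y = z) (h' : y + x = z),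
    (β_ (obj x) (obj y)).hom ≫ add h' = add h
  cont : LC fun p : M × M => add (rfl : p.1 + p.2 = p.1 + p.2)

namespace AddFun

variable {M : Type w} [AddCommGroup M] [TopologicalSpace M]
  {A : Type u} [Category.{v} A] [MonoidalCategory A] [SymmetricCategory A]

theorem obj_lc (F : AddFun M A) : IsLocallyConstant F.obj := by
  have h := IsLocallyConstant.comp (F.cont.pre (φ := fun x : M => (x, (0 : M))) (by fun_prop))
    (fun u => u.right)
  convert h using 1
  ext x
  simp

/-- A (continuous) monoidal natural transformation. -/
@[ext]
structure Hom (F G : AddFun M A) where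
  app : ∀ x, F.obj x ⟶ G.obj x
  app_unit : ∀ {x : M} (h : x = 0), F.unit h ≫ app x = G.unit h
  app_add : ∀ {x y z : M} (h : x + y = z), (app x ⊗ₘ app y) ≫ G.add h = F.add h ≫ app z
  cont : LC app

attribute [simp] Hom.app_unit

@[simp] theorem Hom.app_unit_assoc {F G : AddFun M A} (f : Hom F G) {x : M} (h : x = 0) {a : A}
    (k : G.obj x ⟶ a) : F.unit h ≫ f.app x ≫ k = G.unit h ≫ k := by
  rw [← Category.assoc, f.app_unit]

theorem Hom.app_add_assoc {F G : AddFun M A} (f : Hom F G) {x y z : M} (h : x + y = z) {a : A}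
    (k : G.obj z ⟶ a) : (f.app x ⊗ₘ f.app y) ≫ G.add h ≫ k = F.add h ≫ f.app z ≫ k := by
  rw [← Category.assoc, f.app_add, Category.assoc]

instance : Category (AddFun M A) where
  Hom := Hom
  id F := ⟨fun x => 𝟙 _, by simp, by simp, F.obj_lc.comp (fun a => Arrow.mk (𝟙 a))⟩
  comp f g := ⟨fun x => f.app x ≫ g.app x, by simp, fun h => by
    rw [← tensorHom_comp_tensorHom, Category.assoc, g.app_add, f.app_add_assoc], f.cont.comp g.cont⟩

@[ext] theorem hom_ext {F G : AddFun M A} {f g : F ⟶ G} (h : ∀ x, f.app x = g.app x) : f = g :=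
  Hom.ext (funext h)
@[simp] theorem id_app (F : AddFun M A) (x : M) : Hom.app (𝟙 F) x = 𝟙 _ := rfl
@[simp] theorem comp_app {F G H : AddFun M A} (f : F ⟶ G) (g : G ⟶ H) (x : M) :
  (f ≫ g).app x = f.app x ≫ g.app x := rfl
theorem comp_app_assoc {F G H : AddFun M A} (f : F ⟶ G) (g : G ⟶ H) (x : M) {a : A}
    (k : H.obj x ⟶ a) : (f ≫ g).app x ≫ k = f.app x ≫ g.app x ≫ k := by simp

/-- construct an isomorphism from a pointwise one -/
noncomputable def invHom [IsGroupoid A] {F G : AddFun M A} (f : F ⟶ G) : G ⟶ F where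
  app x := inv (f.app x)
  app_unit h := by rw [IsIso.comp_inv_eq]; exact (f.app_unit h).symm
  app_add h := by
    rw [← inv_tensor, IsIso.inv_comp_eq, ← Category.assoc, IsIso.eq_comp_inv, ← f.app_add]
  cont := f.cont.inv

instance [IsGroupoid A] : IsGroupoid (AddFun M A) where
  all_isIso f := ⟨invHom f, by ext; simp [invHom], by ext; simp [invHom]⟩

@[simp] theorem inv_app [IsGroupoid A] {F G : AddFun M A} (f : F ⟶ G) (x : M) :
    (inv f).app x = inv (f.app x) := by
  rw [← cancel_epi (f.app x), ← comp_app]; simp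

theorem tensorμ_braid (a b c d : A) :
    (β_ (a ⊗ b) (c ⊗ d)).hom ≫ tensorμ c d a b =
      tensorμ a b c d ≫ ((β_ a c).hom ⊗ₘ (β_ b d).hom) := by
  simp [tensorμ, SymmetricCategory.braiding_swap_eq_inv_braiding d a,
    MonoidalCategory.tensorHom_def]

theorem tensorμ_braid' (a b c d : A) :
    tensorμ a b c d ≫ (β_ (a ⊗ c) (b ⊗ d)).hom =
      ((β_ a b).hom ⊗ₘ (β_ c d).hom) ≫ tensorμ b a d c := by
  simp [tensorμ, SymmetricCategory.braiding_swap_eq_inv_braiding c b,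
    MonoidalCategory.tensorHom_def]

/-- pointwise sum -/
abbrev tens (F G : AddFun M A) : AddFun M A where
  obj x := F.obj x ⊗ G.obj x
  unit h := (λ_ _).inv ≫ (F.unit h ⊗ₘ G.unit h)
  add h := tensorμ _ _ _ _ ≫ (F.add h ⊗ₘ G.add h)
  unit_add {o x} h h' := by
    rw [tensor_left_unitality (F.obj x) (G.obj x), ← F.unit_add h h', ← G.unit_add h h']
    rw [comp_whiskerRight, Category.assoc, tensorμ_natural_left_assoc, tensorHom_comp_tensorHom]
  add_assoc {x y z xy yz t} h₁ h₂ h₃ h₄ := by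
    have := tensor_associativity (F.obj x) (G.obj x) (F.obj y) (G.obj y) (F.obj z) (G.obj z)
    simp only [comp_whiskerRight, whiskerLeft_comp, Category.assoc]
    rw [tensorμ_natural_left_assoc, tensorHom_comp_tensorHom, F.add_assoc h₁ h₂ h₃ h₄,
      G.add_assoc h₁ h₂ h₃ h₄, tensorμ_natural_right_assoc, tensorHom_comp_tensorHom,
      ← tensorHom_comp_tensorHom, reassoc_of% this]
  add_comm h h' := by
    rw [← Category.assoc, tensorμ_braid, Category.assoc, tensorHom_comp_tensorHom, F.add_comm h h',
      G.add_comm h h']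
  cont := by
    refine LC.comp ?_ (F.cont.tensor G.cont)
    have hF := F.obj_lc
    have hG := G.obj_lc
    have e1 : IsLocallyConstant (fun p : M × M => ((F.obj p.1, G.obj p.1), (F.obj p.2, G.obj p.2))) :=
      ((hF.comp_continuous continuous_fst).prodMk (hG.comp_continuous continuous_fst)).prodMk
       ((hF.comp_continuous continuous_snd).prodMk (hG.comp_continuous continuous_snd))
    exact e1.comp (fun q => Arrow.mk (tensorμ q.1.1 q.1.2 q.2.1 q.2.2))

/-- the zero functor -/
abbrev unitObj : AddFun M A where
  obj _ := 𝟙_ A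
  unit _ := 𝟙 _
  add _ := (λ_ _).hom
  unit_add := by simp
  add_assoc := by intros; monoidal
  add_comm := by simp [← unitors_equal]
  cont := IsLocallyConstant.const _

/-- pointwise sum of morphisms -/
abbrev tensHom {F F' G G' : AddFun M A} (f : F ⟶ F') (g : G ⟶ G') : tens F G ⟶ tens F' G' where
  app x := f.app x ⊗ₘ g.app x
  app_unit h := by simp [tens]
  app_add h := by
    simp only [tens, tensorμ_natural_assoc, tensorHom_comp_tensorHom, Category.assoc, Hom.app_add]
  cont := f.cont.tensor g.cont

@[simp] theorem tens_obj (F G : AddFun M A) (x : M) : (tens F G).obj x = F.obj x ⊗ G.obj x := rfl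
@[simp] theorem tens_add (F G : AddFun M A) {x y z : M} (h : x + y = z) :
  (tens F G).add h = tensorμ _ _ _ _ ≫ (F.add h ⊗ₘ G.add h) := rfl
@[simp] theorem tens_unit (F G : AddFun M A) {x : M} (h : x = 0) :
  (tens F G).unit h = (λ_ _).inv ≫ (F.unit h ⊗ₘ G.unit h) := rfl
@[simp] theorem unitObj_obj (x : M) : (unitObj : AddFun M A).obj x = 𝟙_ A := rfl
@[simp] theorem unitObj_add {x y z : M} (h : x + y = z) :
  (unitObj : AddFun M A).add h = (λ_ _).hom := rfl
@[simp] theorem unitObj_unit {x : M} (h : x = 0) : (unitObj : AddFun M A).unit h = 𝟙 _ := rfl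

variable [IsGroupoid A]

/-- an isomorphism from a natural transformation with prescribed pointwise inverse -/
def isoOf {F G : AddFun M A} (f : F ⟶ G) (e : ∀ x, G.obj x ⟶ F.obj x)
    (h : ∀ x, f.app x ≫ e x = 𝟙 _) : F ≅ G where
  hom := f
  inv :=
    { app := e
      app_unit := by
        have : e = (inv f).app := by ext x; simp [← cancel_epi (f.app x), h]
        rw [this]; exact fun {_} h => (inv f).app_unit h
      app_add := by
        have : e = (inv f).app := by ext x; simp [← cancel_epi (f.app x), h]
        rw [this]; exact fun {_ _ _} h => (inv f).app_add h
      cont := by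
        have : e = (inv f).app := by ext x; simp [← cancel_epi (f.app x), h]
        rw [this]; exact (inv f).cont }
  hom_inv_id := by ext x; exact h x
  inv_hom_id := by ext x; simp [← cancel_epi (f.app x), reassoc_of% h]

instance : MonoidalCategoryStruct (AddFun M A) where
  tensorObj := tens
  tensorUnit := unitObj
  tensorHom := tensHom
  whiskerLeft F _ _ g := tensHom (𝟙 F) g
  whiskerRight f G := tensHom f (𝟙 G)
  associator F G H := isoOf
    { app := fun x => (α_ (F.obj x) (G.obj x) (H.obj x)).hom
      app_unit := fun h => by dsimp; monoidal
      app_add := fun {x y z} h => by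
        have := associator_monoidal (F.obj x) (G.obj x) (H.obj x) (F.obj y) (G.obj y) (H.obj y)
        dsimp only
        rw [← id_tensorHom, ← tensorHom_id] at this
        have e1 : (F.add h ⊗ₘ tensorμ (G.obj x) (H.obj x) (G.obj y) (H.obj y) ≫
          (G.add h ⊗ₘ H.add h)) = (𝟙 _ ⊗ₘ tensorμ _ _ _ _) ≫ (F.add h ⊗ₘ (G.add h ⊗ₘ H.add h)) := by
          rw [tensorHom_comp_tensorHom, Category.id_comp]
        have e2 : (tensorμ (F.obj x) (G.obj x) (F.obj y) (G.obj y) ≫ (F.add h ⊗ₘ G.add h) ⊗ₘ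
          H.add h) = (tensorμ _ _ _ _ ⊗ₘ 𝟙 _) ≫ ((F.add h ⊗ₘ G.add h) ⊗ₘ H.add h) := by
          rw [tensorHom_comp_tensorHom, Category.id_comp]
        rw [e1, e2, Category.assoc, Category.assoc, associator_naturality, reassoc_of% this]
      cont := (F.obj_lc.prodMk (G.obj_lc.prodMk H.obj_lc)).comp
        (fun a => Arrow.mk (α_ a.1 a.2.1 a.2.2).hom) }
    (fun x => (α_ (F.obj x) (G.obj x) (H.obj x)).inv) (by simp)
  leftUnitor F := isoOf
    { app := fun x => (λ_ (F.obj x)).hom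
      app_unit := fun h => by dsimp; monoidal
      app_add := fun h => by dsimp; rw [leftUnitor_monoidal_assoc]; monoidal
      cont := F.obj_lc.comp (fun a => Arrow.mk (λ_ a).hom) } (fun x => (λ_ (F.obj x)).inv) (by simp)
  rightUnitor F := isoOf
    { app := fun x => (ρ_ (F.obj x)).hom
      app_unit := fun h => by dsimp; monoidal
      app_add := fun h => by dsimp;  rw [rightUnitor_monoidal_assoc]; monoidal
      cont := F.obj_lc.comp (fun a => Arrow.mk (ρ_ a).hom) } (fun x => (ρ_ (F.obj x)).inv) (by simp)

@[simp] theorem tensorObj_eq (F G : AddFun M A) : (F ⊗ G) = tens F G := rfl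
@[simp] theorem tensorUnit_eq : 𝟙_ (AddFun M A) = unitObj := rfl
@[simp] theorem tensorHom_app {F F' G G' : AddFun M A} (f : F ⟶ F') (g : G ⟶ G') (x : M) :
    (f ⊗ₘ g).app x = f.app x ⊗ₘ g.app x := rfl
@[simp] theorem whiskerLeft_app (F : AddFun M A) {G G' : AddFun M A} (g : G ⟶ G') (x : M) :
    (F ◁ g).app x = F.obj x ◁ g.app x := id_tensorHom _ _
@[simp] theorem whiskerRight_app {F F' : AddFun M A} (f : F ⟶ F') (G : AddFun M A) (x : M) :
    (f ▷ G).app x = f.app x ▷ G.obj x := tensorHom_id _ _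
@[simp] theorem associator_hom_app (F G H : AddFun M A) (x : M) :
    (α_ F G H).hom.app x = (α_ (F.obj x) (G.obj x) (H.obj x)).hom := rfl
@[simp] theorem associator_inv_app (F G H : AddFun M A) (x : M) :
    (α_ F G H).inv.app x = (α_ (F.obj x) (G.obj x) (H.obj x)).inv := rfl
@[simp] theorem leftUnitor_hom_app (F : AddFun M A) (x : M) :
    (λ_ F).hom.app x = (λ_ (F.obj x)).hom := rfl
@[simp] theorem leftUnitor_inv_app (F : AddFun M A) (x : M) :
    (λ_ F).inv.app x = (λ_ (F.obj x)).inv := rfl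
@[simp] theorem rightUnitor_hom_app (F : AddFun M A) (x : M) :
    (ρ_ F).hom.app x = (ρ_ (F.obj x)).hom := rfl
@[simp] theorem rightUnitor_inv_app (F : AddFun M A) (x : M) :
    (ρ_ F).inv.app x = (ρ_ (F.obj x)).inv := rfl

instance : MonoidalCategory (AddFun M A) where
  tensorHom_def f g := by ext x; simp [MonoidalCategory.tensorHom_def]
  id_tensorHom_id F G := by ext x; simp 
  tensorHom_comp_tensorHom f g h k := by ext x; simp
  whiskerLeft_id F G := by ext x; simp
  id_whiskerRight F G := by ext x; simp
  associator_naturality f g h := by ext x; simp 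
  leftUnitor_naturality f := by ext x; simp
  rightUnitor_naturality f := by ext x; simp
  pentagon F G H K := by ext x; simp
  triangle F G := by ext x; simp

instance : BraidedCategory (AddFun M A) where
  braiding F G := isoOf
    { app := fun x => (β_ (F.obj x) (G.obj x)).hom
      app_unit := fun h => by
        dsimp only [tensorObj_eq, tens_unit]
        rw [Category.assoc, BraidedCategory.braiding_naturality]
        simp [← unitors_equal]
      app_add := fun {x y z} h => by
        simp only [tensorObj_eq, tens_add]
        have h1 := BraidedCategory.braiding_naturality (F.add h) (G.add h)
        have h2 := tensorμ_braid' (F.obj x) (G.obj x) (F.obj y) (G.obj y)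
        rw [Category.assoc, h1, ← Category.assoc, ← Category.assoc, h2]
      cont := (F.obj_lc.prodMk G.obj_lc).comp (fun a => Arrow.mk (β_ a.1 a.2).hom) }
    (fun x => (β_ (F.obj x) (G.obj x)).inv) (by simp)
  braiding_naturality_right F _ _ f := by ext x; simp [isoOf]
  braiding_naturality_left f G := by ext x; simp [isoOf] 
  hexagon_forward F G H := by ext x; simp [isoOf] 
  hexagon_reverse F G H := by ext x; simp [isoOf] 

@[simp] theorem braiding_hom_app (F G : AddFun M A) (x : M) :
    (β_ F G).hom.app x = (β_ (F.obj x) (G.obj x)).hom := rfl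
@[simp] theorem braiding_inv_app (F G : AddFun M A) (x : M) :
    (β_ F G).inv.app x = (β_ (F.obj x) (G.obj x)).inv := rfl

@[simp] theorem tensorμ_app (F G H K : AddFun M A) (x : M) :
    (tensorμ F G H K).app x = tensorμ (F.obj x) (G.obj x) (H.obj x) (K.obj x) := by
  simp [tensorμ]

instance : SymmetricCategory (AddFun M A) where
  symmetry F G := by ext x; simp 

variable {N : Type w'} [AddCommGroup N] [TopologicalSpace N]

theorem add_add (F : AddFun M A) {a b c d ab cd t bc bcd : M} (h₁ : a + b = ab) (h₂ : c + d = cd)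
    (h₃ : ab + cd = t) (h₄ : b + c = bc) (h₅ : bc + d = bcd) (h₆ : a + bcd = t) :
    (F.add h₁ ⊗ₘ F.add h₂) ≫ F.add h₃ = (α_ _ _ _).hom ≫ (F.obj a ◁ (α_ _ _ _).inv) ≫
      (F.obj a ◁ (F.add h₄ ▷ F.obj d)) ≫ (F.obj a ◁ F.add h₅) ≫ F.add h₆ := by
  have e : b + cd = bcd := by rw [← h₅, ← h₄, ← h₂, _root_.add_assoc]
  have k := F.add_assoc h₄ h₅ h₂ e
  rw [← Iso.inv_comp_eq] at k
  rw [MonoidalCategory.tensorHom_def', Category.assoc, F.add_assoc h₁ h₃ e h₆]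
  rw [associator_naturality_right_assoc, ← whiskerLeft_comp_assoc, ← k]
  simp

theorem medial (F : AddFun M A) {a b c d ab cd ac bd t : M} (h₁ : a + b = ab) (h₂ : c + d = cd)
    (h₃ : ab + cd = t) (h₄ : a + c = ac) (h₅ : b + d = bd) (h₆ : ac + bd = t) :
    (F.add h₁ ⊗ₘ F.add h₂) ≫ F.add h₃ =
      tensorμ _ _ _ _ ≫ (F.add h₄ ⊗ₘ F.add h₅) ≫ F.add h₆ := by
  have e : a + (b + c + d) = t := by rw [← h₃, ← h₁, ← h₂]; abel
  rw [F.add_add h₁ h₂ h₃ rfl rfl e, F.add_add h₄ h₅ h₆ (_root_.add_comm c b) rfl e, tensorμ]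
  simp only [← F.add_comm (rfl : b + c = _) (_root_.add_comm c b)]
  simp

/-- transport along an equality -/
def tr (F : AddFun M A) {x y : M} (h : x = y) : F.obj x ⟶ F.obj y := eqToHom (congrArg F.obj h)

@[simp] theorem tr_rfl (F : AddFun M A) {x : M} (h : x = x) : F.tr h = 𝟙 _ := rfl
@[simp] theorem tr_tr (F : AddFun M A) {x y z : M} (h : x = y) (h' : y = z) :
    F.tr h ≫ F.tr h' = F.tr (h.trans h') := by subst h; simp
@[simp] theorem tr_tr_assoc (F : AddFun M A) {x y z : M} (h : x = y) (h' : y = z) {a : A}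
    (k : F.obj z ⟶ a) : F.tr h ≫ F.tr h' ≫ k = F.tr (h.trans h') ≫ k := by
  rw [← Category.assoc, tr_tr]
@[simp] theorem tens_tr (F G : AddFun M A) {x y : M} (h : x = y) :
    (tens F G).tr h = F.tr h ⊗ₘ G.tr h := by subst h; simp
@[simp] theorem unitObj_tr {x y : M} (h : x = y) :
    (unitObj : AddFun M A).tr h = 𝟙 _ := by subst h; rfl
theorem tr_add (F : AddFun M A) {x y x' y' z z' : M} (h : x + y = z) (h' : x' + y' = z')
    (hx : x = x') (hy : y = y') (hz : z = z') :
    (F.tr hx ⊗ₘ F.tr hy) ≫ F.add h' = F.add h ≫ F.tr hz := by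
  subst hx hy hz; simp
@[simp] theorem unit_tr (F : AddFun M A) {x y : M} (h : x = 0) (e : x = y) :
    F.unit h ≫ F.tr e = F.unit (e.symm.trans h) := by subst e; simp
@[simp] theorem unit_tr_assoc (F : AddFun M A) {x y : M} (h : x = 0) (e : x = y) {a : A}
    (k : F.obj y ⟶ a) : F.unit h ≫ F.tr e ≫ k = F.unit (e.symm.trans h) ≫ k := by
  rw [← Category.assoc, unit_tr]

theorem arrow_add (F : AddFun M A) {x y z z' : M} (h : x + y = z) (h' : x + y = z') :
    Arrow.mk (F.add h) = Arrow.mk (F.add h') := by subst h h'; rfl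

/-- precomposition with a continuous homomorphism -/
abbrev pull (f : N →ₜ+ M) (F : AddFun M A) : AddFun N A where
  obj x := F.obj (f x)
  unit h := F.unit (by rw [h, map_zero])
  add h := F.add (by rw [← map_add, h])
  unit_add _ _ := F.unit_add _ _
  add_assoc _ _ _ _ := F.add_assoc _ _ _ _
  add_comm _ _ := F.add_comm _ _
  cont := by
    have := F.cont.pre (φ := fun p : N × N => (f p.1, f p.2))
      ((f.continuous.comp continuous_fst).prodMk (f.continuous.comp continuous_snd))
    unfold LC at this ⊢
    convert this using 2
    exact F.arrow_add _ _

@[simp] theorem pull_tr (f : N →ₜ+ M) (F : AddFun M A) {x y : N} (h : x = y) :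
    (pull f F).tr h = F.tr (congrArg f h) := by subst h; rfl

/-- precomposition of natural transformations -/
abbrev pullHom (f : N →ₜ+ M) {F G : AddFun M A} (θ : F ⟶ G) : pull f F ⟶ pull f G where
  app x := θ.app (f x)
  app_unit _ := θ.app_unit _
  app_add _ := θ.app_add _
  cont := θ.cont.pre f.continuous

/-- precomposition with equal homomorphisms -/
abbrev pullEq {f g : N →ₜ+ M} (h : ∀ x, f x = g x) (F : AddFun M A) : pull f F ⟶ pull g F where
  app x := F.tr (h x)
  app_unit _ := by simp
  app_add _ := F.tr_add _ _ _ _ _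
  cont := by
    have := (F.obj_lc.comp_continuous f.continuous).comp (fun a => Arrow.mk (𝟙 a))
    unfold LC
    convert this using 2 with x
    refine Arrow.ext rfl (by simp [h]) ?_
    simp [tr]

theorem unit_unit (F : AddFun M A) {x y z : M} (hx : x = 0) (hy : y = 0) (h : x + y = z) :
    (F.unit hx ⊗ₘ F.unit hy) ≫ F.add h = (λ_ (𝟙_ A)).hom ≫ F.unit (by rw [← h, hx, hy, add_zero]) := by
  subst hx hy
  obtain rfl : 0 = z := by simpa using h
  rw [MonoidalCategory.tensorHom_def', Category.assoc, F.unit_add]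
  simp

/-- the isomorphism `F(0) ⟶ 0` -/
def counit (F : AddFun M A) {x : M} (h : x = 0) : F.obj x ⟶ 𝟙_ A := inv (F.unit h)

@[simp] theorem unit_counit (F : AddFun M A) {x : M} (h h' : x = 0) :
    F.unit h ≫ F.counit h' = 𝟙 _ := by simp [counit]
@[simp] theorem unit_counit_assoc (F : AddFun M A) {x : M} (h h' : x = 0) {a : A} (k : 𝟙_ A ⟶ a) :
    F.unit h ≫ F.counit h' ≫ k = k := by rw [← Category.assoc, unit_counit, Category.id_comp]
@[simp] theorem counit_unit (F : AddFun M A) {x : M} (h h' : x = 0) :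
    F.counit h ≫ F.unit h' = 𝟙 _ := by simp [counit]
@[simp] theorem counit_unit_assoc (F : AddFun M A) {x : M} (h h' : x = 0) {a : A}
    (k : F.obj x ⟶ a) : F.counit h ≫ F.unit h' ≫ k = k := by
  rw [← Category.assoc, counit_unit, Category.id_comp]
@[simp] theorem app_counit {F G : AddFun M A} (θ : F ⟶ G) {x : M} (h : x = 0) :
    θ.app x ≫ G.counit h = F.counit h := by
  rw [← cancel_epi (F.unit h)]; simp
@[simp] theorem app_counit_assoc {F G : AddFun M A} (θ : F ⟶ G) {x : M} (h : x = 0) {a : A}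
    (k : 𝟙_ A ⟶ a) : θ.app x ≫ G.counit h ≫ k = F.counit h ≫ k := by
  rw [← Category.assoc, app_counit]
@[simp] theorem counit_tens (F G : AddFun M A) {x : M} (h : x = 0) :
    (tens F G).counit h = (F.counit h ⊗ₘ G.counit h) ≫ (λ_ _).hom := by simp [counit]
@[simp] theorem counit_unitObj {x : M} (h : x = 0) :
    (unitObj : AddFun M A).counit h = 𝟙 _ := by simp [counit]
@[simp] theorem tr_counit (F : AddFun M A) {x y : M} (h : y = 0) (e : x = y) :
    F.tr e ≫ F.counit h = F.counit (e.trans h) := by subst e; simp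
@[simp] theorem tr_counit_assoc (F : AddFun M A) {x y : M} (h : y = 0) (e : x = y) {a : A}
    (k : 𝟙_ A ⟶ a) : F.tr e ≫ F.counit h ≫ k = F.counit (e.trans h) ≫ k := by
  rw [← Category.assoc, tr_counit]
@[simp] theorem add_counit (F : AddFun M A) {x y z : M} (hx : x = 0) (hy : y = 0)
    (h : x + y = z) (hz : z = 0) :
    F.add h ≫ F.counit hz = (F.counit hx ⊗ₘ F.counit hy) ≫ (λ_ _).hom := by
  rw [counit, IsIso.comp_inv_eq, Category.assoc, ← F.unit_unit hx hy h]
  simp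
@[simp] theorem add_counit_assoc (F : AddFun M A) {x y z : M} (hx : x = 0) (hy : y = 0)
    (h : x + y = z) (hz : z = 0) {a : A} (k : 𝟙_ A ⟶ a) :
    F.add h ≫ F.counit hz ≫ k = (F.counit hx ⊗ₘ F.counit hy) ≫ (λ_ _).hom ≫ k := by
  rw [← Category.assoc, F.add_counit hx hy, Category.assoc]

@[simp] theorem counit_pull (f : N →ₜ+ M) (F : AddFun M A) {x : N} (h : x = 0) :
    (pull f F).counit h = F.counit (by rw [h, map_zero]) := rfl

theorem inv_add_counit (F : AddFun M A) {q r k : M} (hq : q = 0) (h : q + r = k) (e : k = r) :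
    inv (F.add h) ≫ (F.counit hq ▷ _) ≫ (λ_ _).hom = F.tr e := by
  subst e
  rw [IsIso.inv_comp_eq, ← cancel_epi (F.unit hq ▷ _), tr_rfl, Category.comp_id, F.unit_add]
  simp [← comp_whiskerRight_assoc]

/-- additivity in the homomorphism -/
abbrev pullAdd {f g k : N →ₜ+ M} (h : ∀ x, f x + g x = k x) (F : AddFun M A) :
    pull f F ⊗ pull g F ⟶ pull k F where
  app x := F.add (h x)
  app_unit {x} hx := by
    refine (Category.assoc _ _ _).trans ?_
    rw [Iso.inv_comp_eq]
    exact F.unit_unit _ _ _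
  app_add {x y z} e := by
    refine Eq.trans ?_ (Category.assoc _ _ _).symm
    exact F.medial _ _ _ _ _ _
  cont := by
    have := F.cont.pre (φ := fun x : N => (f x, g x)) (f.continuous.prodMk g.continuous)
    unfold LC at this ⊢
    convert this using 2
    exact F.arrow_add _ _

/-- the inverse of `pullAdd` -/
def pullSplit {f g k : N →ₜ+ M} (h : ∀ x, f x + g x = k x) (F : AddFun M A) :
    pull k F ⟶ pull f F ⊗ pull g F := invHom (pullAdd h F)

end AddFun

/-- A complex of topological abelian groups `⋯ ⟶ X 2 ⟶ X 1 ⟶ X 0`. -/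
structure Cx where
  X : ℕ → Type w
  [grp : ∀ i, AddCommGroup (X i)]
  [top : ∀ i, TopologicalSpace (X i)]
  [tg : ∀ i, IsTopologicalAddGroup (X i)]
  d : ∀ i, X (i + 1) →ₜ+ X i
  dd : ∀ i x, d i (d (i + 1) x) = 0

attribute [instance] Cx.grp Cx.top Cx.tg

section Homology

variable (M : Cx.{w}) (A : Type u) [Category.{v} A] [MonoidalCategory A] [SymmetricCategory A]
  [IsGroupoid A]

/-- The objects of the (co)homology at the middle term of
`[X 0, A] ⟶ [X 1, A] ⟶ [X 2, A] ⟶ [X 3, A] ⟶ [X 4, A]`: pairs `(F, φ)` with `φ : d F ⟶ 0` and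
`d φ = χ_F`. -/
structure H where
  F : AddFun (M.X 2) A
  φ : F.pull (M.d 2) ⟶ 𝟙_ (AddFun (M.X 3) A)
  cocycle : ∀ x : M.X 4, φ.app (M.d 3 x) = F.counit (M.dd 2 x)

namespace H
variable {M A}

/-- Representatives of morphisms: pairs `(b, f)` with `f : (F, φ) ⟶ (d b + F', χ_b + φ')`. -/
structure Pre (a a' : H M A) where
  b : AddFun (M.X 1) A
  f : a.F ⟶ b.pull (M.d 1) ⊗ a'.F
  comm : ∀ x : M.X 3, f.app (M.d 2 x) ≫ (b.counit (M.dd 1 x) ▷ _) ≫ (λ_ _).hom ≫ a'.φ.app x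
    = a.φ.app x

/-- For `g : b ⟶ d c + b'` the composite `d b ⟶ d d c + d b' ⟶ d b'` of `d g` and `χ_c`. -/
def collapse {b b' : AddFun (M.X 1) A} {c : AddFun (M.X 0) A} (g : b ⟶ c.pull (M.d 0) ⊗ b')
    (x : M.X 2) : b.obj (M.d 1 x) ⟶ b'.obj (M.d 1 x) :=
  g.app (M.d 1 x) ≫ (c.counit (M.dd 0 x) ▷ _) ≫ (λ_ _).hom

/-- The equivalence of representatives: `(c, g)` with `g : b ⟶ d c + b'`. -/
def Rel {a a' : H M A} (p q : Pre a a') : Prop :=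
  ∃ (c : AddFun (M.X 0) A) (g : p.b ⟶ c.pull (M.d 0) ⊗ q.b), ∀ x : M.X 2,
    p.f.app x ≫ (collapse g x ▷ _) = q.f.app x

namespace Pre

theorem rel_of {a a' : H M A} {p q : Pre a a'} (g : p.b ⟶ q.b)
    (h : ∀ x, p.f.app x ≫ (g.app (M.d 1 x) ▷ _) = q.f.app x) : Rel p q :=
  ⟨𝟙_ _, g ≫ (λ_ _).inv, fun x => by rw [← h]; simp [collapse]⟩

/-- the identity representative -/
abbrev id (a : H M A) : Pre a a where
  b := 𝟙_ _
  f := (λ_ _).inv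
  comm x := by simp

/-- composition of representatives -/
abbrev comp {a a' a'' : H M A} (p : Pre a a') (q : Pre a' a'') : Pre a a'' where
  b := p.b ⊗ q.b
  f := p.f ≫ (_ ◁ q.f) ≫ (α_ (p.b.pull (M.d 1)) (q.b.pull (M.d 1)) a''.F).inv
  comm x := by
    have e := whisker_exchange (p.b.counit (M.dd 1 x)) (q.f.app (M.d 2 x))
    have h := p.comm x
    rw [← q.comm x, ← leftUnitor_naturality_assoc, ← reassoc_of% e] at h
    rw [← h]
    simp [MonoidalCategory.tensorHom_def]

theorem comp_rel_left {a a' a'' : H M A} {p p' : Pre a a'} (h : Rel p p') (q : Pre a' a'') :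
    Rel (comp p q) (comp p' q) := by
  obtain ⟨c, g, h⟩ := h
  refine ⟨c, (g ▷ q.b) ≫ (α_ _ _ _).hom, fun x => ?_⟩
  have e : collapse ((g ▷ q.b) ≫ (α_ (c.pull (M.d 0)) p'.b q.b).hom) x = collapse g x ▷ _ := by
    simp [collapse]
  have h1 := whisker_exchange (collapse g x) (q.f.app x)
  rw [e]
  simp [comp, ← h, ← reassoc_of% h1]

theorem comp_rel_right {a a' a'' : H M A} (p : Pre a a') {q q' : Pre a' a''} (h : Rel q q')  :
    Rel (comp p q) (comp p q') := by
  obtain ⟨c, g, h⟩ := h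
  let G := (p.b ◁ g) ≫ (α_ p.b (c.pull (M.d 0)) q'.b).inv ≫ ((β_ _ _).hom ▷ _) ≫ (α_ _ _ _).hom
  refine ⟨c, G, fun x => ?_⟩
  have e : collapse G x = _ ◁ collapse g x := by
    have e := congrArg (· ▷ q'.b.obj (M.d 1 x))
      (BraidedCategory.braiding_naturality_right (p.b.obj (M.d 1 x)) (c.counit (M.dd 0 x)))
    simp only [comp_whiskerRight] at e
    simp [collapse, G, ← reassoc_of% e]
  simp [comp, ← h, e]

theorem _root_.PicCoh.H.Rel.refl {a a' : H M A} (p : Pre a a') : Rel p p :=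
  rel_of (𝟙 _) fun x => by simp

theorem id_comp {a a' : H M A} (p : Pre a a') : Rel (comp (id a) p) p :=
  rel_of (λ_ _).hom fun x => by simp [comp, id]

theorem comp_id {a a' : H M A} (p : Pre a a') : Rel (comp p (id a')) p :=
  rel_of (ρ_ _).hom fun x => by simp [comp, id]

theorem assoc {a a' a'' a''' : H M A} (p : Pre a a') (q : Pre a' a'') (r : Pre a'' a''') :
    Rel (comp (comp p q) r) (comp p (comp q r)) :=
  rel_of (α_ _ _ _).hom fun x => by simp [comp]

end Pre

instance : Category (H M A) where
  Hom a a' := Quot (Rel (a := a) (a' := a'))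
  id a := Quot.mk _ (Pre.id a)
  comp := Quot.map₂ Pre.comp (fun p _ _ h => Pre.comp_rel_right p h) fun _ _ q h => Pre.comp_rel_left h q
  id_comp := by rintro _ _ ⟨p⟩; exact Quot.sound (Pre.id_comp p)
  comp_id := by rintro _ _ ⟨p⟩; exact Quot.sound (Pre.comp_id p)
  assoc := by rintro _ _ _ _ ⟨p⟩ ⟨q⟩ ⟨r⟩; exact Quot.sound (Pre.assoc p q r)

/-- A morphism of cocycles `(F, φ) ⟶ (F', φ')` as a morphism of `H`, with `b = 0`. -/
abbrev Pre.ofHom {a a' : H M A} (f : a.F ⟶ a'.F)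
    (h : ∀ x : M.X 3, f.app (M.d 2 x) ≫ a'.φ.app x = a.φ.app x) : Pre a a' where
  b := 𝟙_ _
  f := f ≫ (λ_ _).inv
  comm x := by rw [← h]; simp

theorem tensorμ_unit {B B' : A} (e : B ⟶ 𝟙_ A) (e' : B' ⟶ 𝟙_ A) (X X' : A) :
    tensorμ B X B' X' ≫ (((e ⊗ₘ e') ≫ (λ_ _).hom) ▷ (X ⊗ X')) ≫ (λ_ _).hom =
      ((e ▷ X) ≫ (λ_ _).hom) ⊗ₘ ((e' ▷ X') ≫ (λ_ _).hom) := by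
  have h := tensorμ_natural e (𝟙 X) e' (𝟙 X')
  rw [id_tensorHom_id, tensorHom_id, tensorHom_id, tensorHom_id] at h
  rw [comp_whiskerRight, Category.assoc, ← reassoc_of% h, ← leftUnitor_monoidal,
    tensorHom_comp_tensorHom]

/-- the sum of two objects -/
abbrev add (a e : H M A) : H M A where
  F := a.F ⊗ e.F
  φ := (a.φ ⊗ₘ e.φ) ≫ (λ_ _).hom
  cocycle x := by simp [a.cocycle, e.cocycle]

/-- the sum of two representatives -/
abbrev Pre.add {a a' e e' : H M A} (p : Pre a a') (q : Pre e e') : Pre (a.add e) (a'.add e') where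
  b := p.b ⊗ q.b
  f := (p.f ⊗ₘ q.f) ≫ tensorμ (p.b.pull (M.d 1)) a'.F (q.b.pull (M.d 1)) e'.F
  comm x := by
    have e := tensorμ_unit (p.b.counit (M.dd 1 x)) (q.b.counit (M.dd 1 x))
      (a'.F.obj (M.d 2 x)) (e'.F.obj (M.d 2 x)) =≫ (a'.add e').φ.app x
    simp only [Category.assoc] at e
    simp only [AddFun.comp_app, AddFun.tensorHom_app, AddFun.tensorμ_app, AddFun.counit_tens,
      AddFun.tensorObj_eq, AddFun.leftUnitor_hom_app, ← p.comm x, ← q.comm x, Category.assoc]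
    erw [e]
    simp

theorem Pre.add_rel {a a' e e' : H M A} {p p' : Pre a a'} {q q' : Pre e e'} (h : Rel p p')
    (h' : Rel q q') : Rel (p.add q) (p'.add q') := by
  obtain ⟨c, g, h⟩ := h
  obtain ⟨c', g', h'⟩ := h'
  let G := (g ⊗ₘ g') ≫ tensorμ (c.pull (M.d 0)) p'.b (c'.pull (M.d 0)) q'.b
  refine ⟨c ⊗ c', G, fun x => ?_⟩
  have e := tensorμ_unit (c.counit (M.dd 0 x)) (c'.counit (M.dd 0 x)) (p'.b.obj (M.d 1 x))
      (q'.b.obj (M.d 1 x))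
  have e : collapse (b' := p'.b ⊗ q'.b) (c := c ⊗ c') G x = collapse g x ⊗ₘ collapse g' x := by
    simp only [collapse, G, AddFun.comp_app, AddFun.tensorHom_app, AddFun.tensorμ_app,
      AddFun.counit_tens, AddFun.tensorObj_eq, Category.assoc]
    erw [e]
    simp
  rw [e]
  have h1 := tensorμ_natural (collapse g x) (𝟙 (a'.F.obj x)) (collapse g' x) (𝟙 (e'.F.obj x))
  rw [id_tensorHom_id, tensorHom_id, tensorHom_id, tensorHom_id] at h1
  simp only [AddFun.comp_app, AddFun.tensorHom_app, AddFun.tensorμ_app, Category.assoc]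
  erw [← h1, tensorHom_comp_tensorHom_assoc, h, h']

/-- the class of a morphism of cocycles -/
abbrev ofHom {a a' : H M A} (f : a.F ⟶ a'.F)
    (h : ∀ x : M.X 3, f.app (M.d 2 x) ≫ a'.φ.app x = a.φ.app x) : a ⟶ a' := Quot.mk _ (Pre.ofHom f h)

theorem ofHom_id (a : H M A) : ofHom (𝟙 a.F) (by simp) = 𝟙 a :=
  Quot.sound (Pre.rel_of (𝟙 _) fun x => by simp)

theorem ofHom_comp {a a' a'' : H M A} (f : a.F ⟶ a'.F) (h) (f' : a'.F ⟶ a''.F) (h') :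
    ofHom f h ≫ ofHom f' h' = ofHom (f ≫ f') (fun x => by simp [h, h']) :=
  Quot.sound (Pre.rel_of (λ_ _).hom fun x => by simp)

/-- the class of an isomorphism of cocycles -/
@[simps] def ofIso {a a' : H M A} (f : a.F ≅ a'.F)
    (h : ∀ x : M.X 3, f.hom.app (M.d 2 x) ≫ a'.φ.app x = a.φ.app x) : a ≅ a' where
  hom := ofHom f.hom h
  inv := ofHom f.inv (fun x => by rw [← h, ← AddFun.comp_app_assoc, f.inv_hom_id]; simp)
  hom_inv_id := by rw [ofHom_comp, ← ofHom_id]; simp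
  inv_hom_id := by rw [ofHom_comp, ← ofHom_id]; simp

/-- the sum of two morphisms -/
def addHom {a a' e e' : H M A} : (a ⟶ a') → (e ⟶ e') → (a.add e ⟶ a'.add e') :=
  Quot.map₂ Pre.add (fun _ _ _ h => Pre.add_rel (.refl _) h) (fun _ _ _ h => Pre.add_rel h (.refl _))

end H

/-- A map of complexes. -/
structure CxMap (M N : Cx.{w}) where
  T : ∀ i, M.X i →ₜ+ N.X i
  comm : ∀ i x, T i (M.d i x) = N.d i (T (i + 1) x)

variable {M A} {N : Cx.{w}}

namespace H

theorem φ_eq (a : H M A) {x : M.X 3} {y : M.X 4} (h : x = M.d 3 y) :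
    a.φ.app x = a.F.counit (by rw [h, M.dd]) := by
  subst h; exact a.cocycle y

/-- precomposition of a cocycle with a map of complexes -/
abbrev mapObj (T : CxMap M N) (a : H N A) : H M A where
  F := a.F.pull (T.T 2)
  φ := AddFun.pullEq (f := (T.T 2).comp (M.d 2)) (g := (N.d 2).comp (T.T 3)) (T.comm 2) a.F ≫
    AddFun.pullHom (T.T 3) a.φ
  cocycle x := by
    change a.F.tr (T.comm 2 _) ≫ a.φ.app (T.T 3 (M.d 3 x)) = a.F.counit _
    rw [a.φ_eq (T.comm 3 x)]
    simp

theorem Pre.comm' {a a' : H M A} (p : Pre a a') {x : M.X 3} {y : M.X 2} {z : M.X 1}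
    (hy : y = M.d 2 x) (hz : M.d 1 y = z) (hz0 : z = 0) :
    (p.f.app y ≫ (p.b.tr hz ⊗ₘ 𝟙 _)) ≫ (p.b.counit hz0 ▷ _) ≫ (λ_ _).hom ≫ a'.F.tr hy ≫
      a'.φ.app x = a.F.tr hy ≫ a.φ.app x := by
  subst hy hz; simp [← p.comm]

/-- precomposition of a representative with a map of complexes -/
abbrev mapPre (T : CxMap M N) {a a' : H N A} (p : Pre a a') : Pre (mapObj T a) (mapObj T a') where
  b := p.b.pull (T.T 1)
  f := AddFun.pullHom (T.T 2) p.f ≫ (AddFun.pullEq (f := (N.d 1).comp (T.T 2))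
    (g := (T.T 1).comp (M.d 1)) (fun x => (T.comm 1 x).symm) p.b ▷ a'.F.pull (T.T 2))
  comm x := p.comm' (T.comm 2 x) (T.comm 1 _).symm
    ((congrArg (T.T 1) (M.dd 1 x)).trans (map_zero _))

theorem mapPre_rel (T : CxMap M N) {a a' : H N A} {p q : Pre a a'} (h : Rel p q) :
    Rel (mapPre T p) (mapPre T q) := by
  obtain ⟨c, g, h⟩ := h
  let e := AddFun.pullEq (f := (N.d 0).comp (T.T 1))
    (g := (T.T 0).comp (M.d 0)) (fun x => (T.comm 0 x).symm) c ▷ q.b.pull (T.T 1)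
  refine ⟨c.pull (T.T 0), by exact AddFun.pullHom (T.T 1) g ≫ e, fun x => ?_⟩
  have key : ∀ {x : N.X 2} {y : N.X 1} {z : N.X 0} (hy : N.d 1 x = y) (hz : N.d 0 y = z)
      (hz0 : z = 0),
      (p.f.app x ≫ (p.b.tr hy ⊗ₘ 𝟙 _)) ≫ (((g.app y ≫ (c.tr hz ⊗ₘ 𝟙 _)) ≫ (c.counit hz0 ▷ _) ≫
        (λ_ _).hom) ▷ _) = q.f.app x ≫ (q.b.tr hy ⊗ₘ 𝟙 _) := by
    intro x y z hy hz hz0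
    subst hy hz; simp [← h, collapse]
  exact key (T.comm 1 x).symm (T.comm 0 _).symm
    ((congrArg (T.T 0) (M.dd 0 x)).trans (map_zero _))

/-- The functor on cohomology induced by a map of complexes. -/
def map (T : CxMap M N) : H N A ⥤ H M A where
  obj := mapObj T
  map := Quot.map (mapPre T) fun _ _ => mapPre_rel T
  map_id a := Quot.sound (Pre.rel_of (by exact 𝟙 (AddFun.unitObj)) fun x => by
    change ((λ_ (a.F.obj (T.T 2 x))).inv ≫ ((AddFun.unitObj : AddFun (N.X 1) A).tr
      (T.comm 1 x).symm ⊗ₘ 𝟙 _)) ≫ (𝟙 (𝟙_ A) ▷ (a.F.obj (T.T 2 x))) = (λ_ _).inv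
    simp)
  map_comp := by
    rintro a a' a'' ⟨p⟩ ⟨q⟩
    refine Quot.sound (Pre.rel_of (by exact 𝟙 (mapPre T (p.comp q)).b) fun x => ?_)
    have key : ∀ {x : N.X 2} {y : N.X 1} (hy : N.d 1 x = y),
      ((p.comp q).f.app x ≫ ((p.b ⊗ q.b).tr hy ⊗ₘ 𝟙 _)) ≫ (𝟙 _ ▷ (a''.F.obj x)) =
      (p.f.app x ≫ (p.b.tr hy ⊗ₘ 𝟙 _)) ≫ (𝟙 _ ⊗ₘ (q.f.app x ≫ (q.b.tr hy ⊗ₘ 𝟙 _))) ≫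
        (α_ _ _ _).inv := by
      intro x y hy
      subst hy; simp
    exact key (T.comm 1 x).symm

/-- precomposition is additive -/
def mapAdd (T : CxMap M N) (a e : H N A) : add ((map T).obj a) ((map T).obj e) ≅ (map T).obj (add a e) :=
  ofIso (Iso.refl _) fun x => by
    have key : ∀ {x : N.X 3} {y : N.X 2} (hy : y = N.d 2 x),
        𝟙 _ ≫ (a.add e).F.tr hy ≫ (a.add e).φ.app x =
        ((a.F.tr hy ≫ a.φ.app x) ⊗ₘ (e.F.tr hy ≫ e.φ.app x)) ≫ (λ_ (𝟙_ A)).hom := by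
      intro x y hy
      subst hy; simp
    exact key (T.comm 2 x)

/-- For `x = d u + y`, the isomorphism `F(x) ⟶ F(d u) + F(y) ⟶ F(y)` given by `φ(u)`. -/
def sh (a : H M A) (u : M.X 3) {x y : M.X 2} (h : M.d 2 u + y = x) : a.F.obj x ⟶ a.F.obj y :=
  inv (a.F.add h) ≫ (a.φ.app u ⊗ₘ 𝟙 _) ≫ (λ_ _).hom

theorem add_sh (a : H M A) (u : M.X 3) {x y : M.X 2} (h : M.d 2 u + y = x) :
    a.F.add h ≫ a.sh u h = (a.φ.app u ▷ _) ≫ (λ_ _).hom := by simp [sh]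

theorem add_sh' (a : H M A) (u : M.X 3) {x y z x' y' : M.X 2} (h : M.d 2 u + y = x)
    (hx : x + z = x') (hy : y + z = y') (h' : M.d 2 u + y' = x') :
    a.F.add hx ≫ a.sh u h' = (a.sh u h ▷ _) ≫ a.F.add hy := by
  have e := a.F.add_assoc h hx hy h'
  rw [← cancel_epi (a.F.add h ▷ _), reassoc_of% e, add_sh, ← comp_whiskerRight_assoc, add_sh]
  simp [whisker_exchange_assoc]

theorem sh_sh (a : H M A) {u v w : M.X 3} {x y z : M.X 2} (h : M.d 2 u + y = x)
    (h' : M.d 2 v + z = y) (h'' : M.d 2 w + z = x) (e : u + v = w) :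
    a.sh u h ≫ a.sh v h' = a.sh w h'' := by
  have e' : M.d 2 u + M.d 2 v = M.d 2 w := by rw [← map_add, e]
  have h1 := a.F.add_assoc e' h'' h' h
  have h2 := a.φ.app_add e
  rw [← cancel_epi (a.F.add e' ▷ _ ≫ a.F.add h''), Category.assoc, Category.assoc, add_sh]
  rw [reassoc_of% h1]
  rw [reassoc_of% a.add_sh, ← comp_whiskerRight_assoc, ← h2]
  have h3 := a.add_sh v h'
  simp [h3, whisker_exchange_assoc, MonoidalCategory.tensorHom_def]

theorem sh_φ (a : H M A) {u v w : M.X 3} {x : M.X 2} (h : M.d 2 u + M.d 2 v = x) 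
    (e : u + v = w) (e' : x = M.d 2 w) :
    a.sh u h ≫ a.φ.app v = a.F.tr e' ≫ a.φ.app w := by
  have h2 := a.φ.app_add e
  subst e'
  rw [← cancel_epi (a.F.add h), reassoc_of% a.add_sh]
  rw [AddFun.tr_rfl, Category.id_comp]
  refine Eq.trans ?_ h2
  simp [MonoidalCategory.tensorHom_def]

theorem sh_zero (a : H M A) {u : M.X 3} {w : M.X 4} {x y : M.X 2} (h : M.d 2 u + y = x) 
    (e : u = M.d 3 w) (e' : x = y) :
    a.sh u h = a.F.tr e' := by
  subst e'
  rw [← cancel_epi (a.F.add h), add_sh, a.φ_eq e, ← cancel_epi (a.F.unit (by rw [e, M.dd]) ▷ _),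
    AddFun.tr_rfl, Category.comp_id, a.F.unit_add]
  simp [← comp_whiskerRight_assoc]


/-- `sh` as a natural transformation -/
def shHom (a : H N A) {X : Type w} [AddCommGroup X] [TopologicalSpace X] (U : X →ₜ+ N.X 3)
    (f g : X →ₜ+ N.X 2) (h : ∀ x, N.d 2 (U x) + g x = f x) : a.F.pull f ⟶ a.F.pull g :=
  AddFun.pullSplit (f := (N.d 2).comp U) h a.F ≫
    (by exact AddFun.pullHom U a.φ ▷ a.F.pull g) ≫ (λ_ _).hom

theorem shHom_app (a : H N A) {X : Type w} [AddCommGroup X] [TopologicalSpace X] (U : X →ₜ+ N.X 3)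
    (f g : X →ₜ+ N.X 2) (h : ∀ x, N.d 2 (U x) + g x = f x) (x : X) :
    (a.shHom U f g h).app x = a.sh (U x) (h x) := by
  rfl

end H

/-- A homotopy `s` between maps of complexes: `T - T' = d s + s d`. -/
structure Htpy (T T' : CxMap M N) where
  s : ∀ i, M.X i →ₜ+ N.X (i + 1)
  h : ∀ i x, N.d (i + 1) (s (i + 1) x) + (s i (M.d i x) + T'.T (i + 1) x) = T.T (i + 1) x

namespace H

/-- The isomorphism `(F T, φ T) ⟶ (F T', φ T')` given by a homotopy. -/
abbrev htpyPre {T T' : CxMap M N} (s : Htpy T T') (a : H N A) :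
    Pre ((map T).obj a) ((map T').obj a) where
  b := a.F.pull (s.s 1)
  f := a.shHom (s.s 2) (T.T 2) ((s.s 1).comp (M.d 1) + T'.T 2) (s.h 1) ≫
    AddFun.pullSplit (f := (s.s 1).comp (M.d 1)) (g := T'.T 2) (fun x => rfl) a.F
  comm x := by
    have key : ∀ {u v z : N.X 3} {w : N.X 4} {p q r k : N.X 2} (hp : p = N.d 2 z) (hq : q = 0)
        (hr : r = N.d 2 v) (hk : q + r = k) (h1 : N.d 2 u + k = p) (h2 : N.d 3 w + (u + v) = z),
        (a.sh u h1 ≫ inv (a.F.add hk)) ≫ (a.F.counit hq ▷ a.F.obj r) ≫ (λ_ _).hom ≫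
          a.F.tr hr ≫ a.φ.app v = a.F.tr hp ≫ a.φ.app z := by
      intro u v z w p q r k hp hq hr hk h1 h2
      subst hr
      obtain rfl : k = N.d 2 v := by rw [← hk, hq, zero_add]
      have e1 : p = N.d 2 (u + v) := by rw [← h1, map_add]
      have e2 : N.d 2 (N.d 3 w) + N.d 2 (u + v) = p := by rw [N.dd, zero_add, e1]
      have e3 := a.sh_φ e2 h2 hp
      rw [a.sh_zero e2 rfl e1] at e3
      rw [Category.assoc, reassoc_of% a.F.inv_add_counit hq hk rfl, ← e3, ← a.sh_φ h1 rfl e1]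
      simp
    have e := key (T.comm 2 x) (by rw [M.dd, map_zero]) (T'.comm 2 x) rfl (s.h 1 (M.d 2 x)) (s.h 2 x)
    exact e

/-- A homotopy between homotopies. -/
structure _root_.PicCoh.Htpy2 {T T' : CxMap M N} (s s' : Htpy T T') where
  t : ∀ i, M.X i →ₜ+ N.X (i + 2)
  h : ∀ i x, N.d (i + 2) (t (i + 1) x) + (s'.s (i + 1) x - t i (M.d i x)) = s.s (i + 1) x

theorem htpyPre_rel {T T' : CxMap M N} {s s' : Htpy T T'} (t : Htpy2 s s') (a : H N A) :
    Rel (htpyPre s a) (htpyPre s' a) := by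
  let g := a.shHom (t.t 1) (s.s 1) ((-(t.t 0)).comp (M.d 0) + s'.s 1) (fun x => by
    rw [← t.h 0 x, sub_eq_neg_add]; rfl) ≫ AddFun.pullSplit (f := (-(t.t 0)).comp (M.d 0))
      (g := s'.s 1) (fun x => rfl) a.F
  refine ⟨a.F.pull (-(t.t 0)), by exact g, fun x => ?_⟩
  have key : ∀ {u u' m : N.X 3} {w : N.X 4} {p q q' r k k' n l : N.X 2} (hk : q + r = k)
      (hk' : q' + r = k') (h1 : N.d 2 u + k = p) (h1' : N.d 2 u' + k' = p) (hn : n = 0)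
      (hl : n + q' = l) (h2 : N.d 2 m + l = q) (h : N.d 3 w + (u' - m) = u),
      (a.sh u h1 ≫ inv (a.F.add hk)) ≫ (((a.sh m h2 ≫ inv (a.F.add hl)) ≫
        (a.F.counit hn ▷ _) ≫ (λ_ _).hom) ▷ a.F.obj r) = a.sh u' h1' ≫ inv (a.F.add hk') := by
    intro u u' m w p q q' r k k' n l hk hk' h1 h1' hn hl h2 h
    obtain rfl : l = q' := by rw [← hl, hn, zero_add]
    have h3 : N.d 2 m + k' = k := by rw [← hk', ← add_assoc, h2, hk]
    have h4 : N.d 2 (N.d 3 w) + p = p := by rw [N.dd, zero_add]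
    have h5 : N.d 2 (u + m) + k' = p := by rw [map_add, add_assoc, h3, h1]
    rw [Category.assoc (a.sh m h2), a.F.inv_add_counit hn hl rfl, AddFun.tr_rfl, Category.comp_id,
      IsIso.eq_comp_inv, Category.assoc, Category.assoc, ← a.add_sh' m h2 hk hk' h3,
      IsIso.inv_hom_id_assoc, a.sh_sh h1 h3 h5 rfl, ← a.sh_sh h4 h1' h5 (by rw [← h]; abel),
      a.sh_zero h4 rfl rfl]
    simp
  exact key rfl rfl (s.h 1 x) (s'.h 1 x)
    (n := (-(t.t 0)) (M.d 0 (M.d 1 x))) (by rw [M.dd, map_zero]) rfl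
    (by rw [← t.h 0, sub_eq_neg_add]; rfl) (t.h 1 x)

/-- The isomorphism `F T + F T' ⟶ F (T + T')`. -/
def mapSum {T T' T'' : CxMap M N} (h : ∀ i x, T.T i x + T'.T i x = T''.T i x) (a : H N A) :
    add ((map T).obj a) ((map T').obj a) ⟶ (map T'').obj a :=
  ofHom (AddFun.pullAdd (h 2) a.F) fun x => by
    have e := a.φ.app_add (h 3 x)
    have key : ∀ {p q r : N.X 3} {p' q' r' : N.X 2} (hp : p' = N.d 2 p) (hq : q' = N.d 2 q)
        (hr : r' = N.d 2 r) (h : p + q = r) (h' : p' + q' = r'), 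
        a.F.add h' ≫ a.F.tr hr ≫ a.φ.app r = ((a.F.tr hp ≫ a.φ.app p) ⊗ₘ (a.F.tr hq ≫ a.φ.app q))
         ≫ (λ_ _).hom := by
      intro p q r p' q' r' hp hq hr h h'
      subst hp hq hr
      simpa using (a.φ.app_add h).symm
    exact key (T.comm 2 x) (T'.comm 2 x) (T''.comm 2 x) (h 3 x) (h 2 _)

end H

end Homology

section Simplicial

variable (X : SSet.{w})

/-- The simplices of degree `n`. For `n < 0` this is a junk value; chains and cochains of negative
degree are put equal to zero below. -/
abbrev S (n : ℤ) : Type w := X.obj (op ⦋n.toNat⦌)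

variable {X}

/-- The simplex with vertices `x_{φ 0}, …, x_{φ b}` of a simplex `x` of degree `a`. -/
def act (φ : ℕ →o ℕ) {a : ℤ} (b : ℤ) (x : S X a) : S X b :=
  X.map (SimplexCategory.mkHom
    ⟨fun i : Fin (b.toNat + 1) => (⟨min (φ i) a.toNat, by omega⟩ : Fin (a.toNat + 1)),
      fun i j h => by
        have := φ.monotone (show (i : ℕ) ≤ j from h)
        simp only [Fin.mk_le_mk]; omega⟩).op x

theorem act_act (φ ψ θ : ℕ →o ℕ) {a b c : ℤ} (x : S X a)
    (h : ∀ i ≤ c.toNat, min (φ (min (ψ i) b.toNat)) a.toNat = min (θ i) a.toNat) :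
    act ψ c (act φ b x) = act θ c x := by
  unfold act
  rw [← ConcreteCategory.comp_apply, ← X.map_comp, ← op_comp]
  congr 3
  refine congrArg _ (SimplexCategory.Hom.ext _ _ (OrderHom.ext _ _ (funext fun i => Fin.ext ?_)))
  exact h i (Nat.le_of_lt_succ i.2)

/-- the vertices of the `j`th face -/
def face (j : ℕ) : ℕ →o ℕ := ⟨fun i => if i < j then i else i + 1, fun a b h => by
  dsimp only; split_ifs <;> omega⟩
@[simp] theorem face_apply (j i : ℕ) : face j i = if i < j then i else i + 1 := rfl

/-- the vertices from the `s`th on -/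
def back (s : ℕ) : ℕ →o ℕ := ⟨fun i => i + s, fun a b h => by dsimp only; omega⟩

@[simp] theorem back_apply (s i : ℕ) : back s i = i + s := rfl

theorem alternating {G : Type*} [AddCommGroup G] (n : ℕ) (F : ℕ → ℕ → G)
    (hF : ∀ i j, i < j → j ≤ n + 1 → F j i = F i (j - 1)) :
    ∑ j ∈ Finset.range (n + 2), ∑ i ∈ Finset.range (n + 1), (-1 : ℤ) ^ (i + j) • F j i = 0 := by
  rw [← Finset.sum_product']
  refine Finset.sum_involution (fun p _ => if p.2 < p.1 then (p.2, p.1 - 1) else (p.2 + 1, p.1))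
    ?_ ?_ ?_ ?_
  · rintro ⟨j, i⟩ h
    simp only [Finset.mem_product, Finset.mem_range] at h ⊢
    split_ifs with h1
    · rw [hF i j h1 (by omega), show i + j = j - 1 + i + 1 by omega, pow_succ]
      simp
    · dsimp only
      rw [hF j (i + 1) (by omega) (by omega), show j + (i + 1) = i + j + 1 by omega, pow_succ]
      simp
  · rintro ⟨j, i⟩ h _
    dsimp only
    split_ifs with h1 <;> simp only [ne_eq, Prod.mk.injEq] <;> omega
  · rintro ⟨j, i⟩ h
    simp only [Finset.mem_product, Finset.mem_range] at h ⊢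
    split_ifs with h1 <;> dsimp only <;> omega
  · rintro ⟨j, i⟩ h
    simp only [Finset.mem_product, Finset.mem_range] at h ⊢
    rcases lt_or_ge i j with h1 | h1
    · simp only [h1, if_true, if_neg (show ¬ j - 1 < i by omega), Prod.mk.injEq, and_true]
      omega
    · simp [not_lt.2 h1, show j < i + 1 by omega]

variable (Y : X.Subcomplex)

/-- Integral cochains of degree `n` that vanish on `Y` (zero for `n < 0`). -/
def LSub (n : ℤ) : AddSubgroup (S X n → ℤ) where
  carrier := {g | ∀ x, n < 0 ∨ x ∈ Y.obj _ → g x = 0}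
  add_mem' h h' x hx := by simp [h x hx, h' x hx]
  zero_mem' := by simp
  neg_mem' h x hx := by simp [h x hx]

/-- The group of integral cochains of degree `n` that vanish on `Y`, with the topology of pointwise
convergence. -/
abbrev L (n : ℤ) : Type w := LSub Y n

/-- Integral chains of degree `n` (zero for `n < 0`). -/
def KSub (X : SSet.{w}) (n : ℤ) : AddSubgroup (S X n →₀ ℤ) where
  carrier := {z | n < 0 → z = 0}
  add_mem' h h' x := by simp [h x, h' x]
  zero_mem' := by simp
  neg_mem' h x := by simp [h x]

/-- The group of integral chains of degree `n`, with the discrete topology. -/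
abbrev K (X : SSet.{w}) (n : ℤ) : Type w := KSub X n

instance (n : ℤ) : TopologicalSpace (K X n) := ⊥
instance (n : ℤ) : DiscreteTopology (K X n) := ⟨rfl⟩

variable {Y}

@[ext] theorem L_ext {n : ℤ} {g g' : L Y n} (h : ∀ x, 0 ≤ n → g.1 x = g'.1 x) : g = g' :=
  Subtype.ext (funext fun x => (le_or_gt 0 n).elim (h x) fun hn => by
    rw [g.2 x (.inl hn), g'.2 x (.inl hn)])

@[ext] theorem K_ext {n : ℤ} {z z' : K X n} (h : 0 ≤ n → z.1 = z'.1) : z = z' :=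
  Subtype.ext ((le_or_gt 0 n).elim h fun hn => by rw [z.2 hn, z'.2 hn])

theorem mem_act {a b : ℤ} (φ : ℕ →o ℕ) {x : S X a} (h : x ∈ Y.obj _) : act φ b x ∈ Y.obj _ :=
  Y.map _ h

variable (Y) in
/-- the coboundary operator -/
def δ {a b : ℤ} (h : a + 1 = b) : L Y a →ₜ+ L Y b where
  toFun g := ⟨fun x => ∑ j ∈ Finset.range (b.toNat + 1), (-1) ^ j * g.1 (act (face j) a x),
    fun x hx => Finset.sum_eq_zero fun j _ => by
      rw [g.2 _ (hx.imp (by omega) (mem_act _)), mul_zero]⟩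
  map_zero' := by ext; simp
  map_add' g g' := by ext; simp [mul_add, Finset.sum_add_distrib]
  continuous_toFun := by
    refine Continuous.subtype_mk (continuous_pi fun x => continuous_finsetSum _ fun j _ => ?_) _
    exact continuous_const.mul ((continuous_apply _).comp continuous_subtype_val)

/-- the alternating sum of the faces of chains -/
def bd (a b : ℤ) : (S X b →₀ ℤ) →+ (S X a →₀ ℤ) :=
  Finsupp.liftAddHom fun x => ∑ j ∈ Finset.range (b.toNat + 1),
    (-1 : ℤ) ^ j • Finsupp.singleAddHom (act (face j) a x)

/-- an operator on chains, put equal to `0` if the target has negative degree -/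
def toK {a b : ℤ} (f : (S X b →₀ ℤ) →+ (S X a →₀ ℤ)) : K X b →+ K X a :=
  ((if a < 0 then 0 else f).comp (KSub X b).subtype).codRestrict (KSub X a) fun z h => by simp [h]

theorem toK_val {a b : ℤ} (f : (S X b →₀ ℤ) →+ (S X a →₀ ℤ)) (h : 0 ≤ a) (z : K X b) :
    (toK f z).1 = f z.1 := by
  change (if a < 0 then 0 else f) z.1 = _
  rw [if_neg (by omega)]

/-- the boundary operator -/
def d {a b : ℤ} (_ : a + 1 = b) : K X b →ₜ+ K X a := ⟨toK (bd a b), continuous_of_discreteTopology⟩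

theorem face_face {a b c : ℤ} (h : a + 1 = b) (h' : b + 1 = c) (ha : 0 ≤ a) {i j : ℕ} (hij : i < j)
    (hj : j ≤ c.toNat) (x : S X c) : act (face i) a (act (face j) b x) =
      act (face (j - 1)) a (act (face i) b x) := by
  rw [act_act _ _ ((face j).comp (face i)), act_act (face i) _ ((face j).comp (face i))]
  all_goals
    intro k hk
    simp only [face_apply, OrderHom.comp_coe, Function.comp]
    split_ifs <;> omega

theorem δδ {a b c : ℤ} (h : a + 1 = b) (h' : b + 1 = c) (g : L Y a) : δ Y h' (δ Y h g) = 0 := by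
  ext x hc
  rcases lt_or_ge a 0 with ha | ha
  · obtain rfl : g = 0 := by ext; omega
    simp
  have e := alternating a.toNat.succ (fun j i => g.1 (act (face i) a (act (face j) b x)))
    fun i j hij hj => by rw [face_face h h' ha hij (by omega)]
  rw [show a.toNat.succ + 2 = c.toNat + 1 by omega, show a.toNat.succ + 1 = b.toNat + 1 by omega] at e
  refine Eq.trans ?_ e
  change ∑ j ∈ Finset.range (c.toNat + 1), (-1) ^ j * ∑ i ∈ Finset.range (b.toNat + 1),
    (-1) ^ i * g.1 (act (face i) a (act (face j) b x)) = _
  simp only [Finset.mul_sum, smul_eq_mul, pow_add]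
  exact Finset.sum_congr rfl fun j _ => Finset.sum_congr rfl fun i _ => by ring

theorem bd_single (a b : ℤ) (x : S X b) (c : ℤ) : bd a b (Finsupp.single x c) =
    ∑ j ∈ Finset.range (b.toNat + 1), (-1 : ℤ) ^ j • Finsupp.single (act (face j) a x) c := by
  simp [bd, AddMonoidHom.finsetSum_apply]

theorem d_val {a b : ℤ} (h : a + 1 = b) (ha : 0 ≤ a) (z : K X b) : (d h z).1 = bd a b z.1 :=
  toK_val _ ha z

theorem dd {a b c : ℤ} (h : a + 1 = b) (h' : b + 1 = c) (z : K X c) : d h (d h' z) = 0 := by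
  ext1 ha
  rw [d_val _ ha, d_val _ (by omega)]
  generalize z.1 = z
  induction z using Finsupp.induction_linear with
  | zero => simp
  | add x y hx hy => simp_all
  | single x r =>
    have e := alternating a.toNat.succ
      (fun j i => Finsupp.single (act (face i) a (act (face j) b x)) r)
      fun i j hij hj => by rw [face_face h h' ha hij (by omega)]
    rw [show a.toNat.succ + 2 = c.toNat + 1 by omega, show a.toNat.succ + 1 = b.toNat + 1 by omega] at e
    refine Eq.trans ?_ e
    simp only [bd_single, map_sum, map_zsmul, Finset.smul_sum, smul_smul, pow_add, mul_comm]

/-- The unsigned cap product: `g` evaluated on the back face times the front face. -/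
def cap₀ (q m p : ℤ) : (S X p →₀ ℤ) →+ (S X m → ℤ) →+ (S X q →₀ ℤ) :=
  Finsupp.liftAddHom fun x => zmultiplesHom _ ((Finsupp.singleAddHom (act OrderHom.id q x)).comp
    (Pi.evalAddMonoidHom (fun _ => ℤ) (act (back q.toNat) m x)))

theorem cap₀_single (q m p : ℤ) (x : S X p) (c : ℤ) (g : S X m → ℤ) : cap₀ q m p (.single x c) g =
    Finsupp.single (act OrderHom.id q x) (c * g (act (back q.toNat) m x)) := by
  simp [cap₀]

/-- The sign that makes the cap product compatible with the differentials. It occurs in the cap product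
of a chain of degree `p` with a cohomology class of degree `q`. -/
def ε (p q : ℤ) : ℤ := (p * q + q * (q + 1) / 2).negOnePow

/-- The cap product of an integral chain of degree `p` and an integral cochain of degree `m`, with
front faces of degree `q`. -/
def cap {p q m : ℤ} (_ : q + m = p) (z : K X p) : L Y m →ₜ+ K X q where
  toFun g := ⟨if q < 0 then 0 else ε p q • cap₀ q m p z.1 g.1, fun h => by simp [h]⟩
  map_zero' := by ext1 h; simp
  map_add' g g' := by ext1 h; simp [not_lt.2 h]
  continuous_toFun := by
    refine IsLocallyConstant.continuous ((IsLocallyConstant.iff_eventually_eq _).2 fun g => ?_)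
    have h : ∀ᶠ g' : L Y m in nhds g, ∀ x ∈ z.1.support,
        g'.1 (act (back q.toNat) m x) = g.1 (act (back q.toNat) m x) :=
      (Filter.eventually_all_finset _).2 fun x _ =>
        (((continuous_apply (act (back q.toNat) m x)).comp
          continuous_subtype_val).tendsto g).eventually (p := fun y => y = g.1 _)
            (mem_nhds_discrete.2 rfl)
    filter_upwards [h] with g' h
    have e : cap₀ q m p z.1 g'.1 = cap₀ q m p z.1 g.1 := by
      simp only [cap₀, Finsupp.liftAddHom_apply, Finsupp.sum, AddMonoidHom.finsetSum_apply]
      exact Finset.sum_congr rfl fun x hx => by simp [h x hx]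
    ext1 hq
    simp [e]

theorem cap_val {p q m : ℤ} (h : q + m = p) (hq : 0 ≤ q) (z : K X p) (g : L Y m) :
    (cap h z g).1 = ε p q • cap₀ q m p z.1 g.1 := if_neg (not_lt.2 hq)

theorem cap_add {p q m : ℤ} (h : q + m = p) (z z' : K X p) (g : L Y m) :
    cap h (z + z') g = cap h z g + cap h z' g := by
  ext1 hq
  simp [cap_val, hq]

theorem cap_neg {p q m : ℤ} (h : q + m = p) (z : K X p) (g : L Y m) :
    cap h (-z) g = - cap h z g := by
  rw [eq_neg_iff_add_eq_zero, ← cap_add]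
  ext1 hq
  simp [cap_val, hq]

theorem cap_δ {p p' q q' m m' : ℤ} (hm : m + 1 = m') (hp : p' + 1 = p) (hq : q + 1 = q')
    (h : q + m' = p) (h₁ : q + m = p') (h₂ : q' + m = p) (z : K X p) (g : L Y m) :
    cap h z (δ Y hm g) = cap h₁ (d hp z) g + (p.negOnePow : ℤ) • d hq (cap h₂ z g) := by
  ext1 hq0
  rcases lt_or_ge m 0 with hm0 | hm0
  · obtain rfl : g = 0 := by ext; omega
    simp
  have e1 : ε p' q = ε p q * q.negOnePow := by
    rw [ε, ε, ← Units.val_mul, ← Int.negOnePow_add, ← hp, Units.val_inj, Int.negOnePow_eq_iff]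
    exact ⟨-q, by ring⟩
  have e2 : ε p q' = ε p q * p.negOnePow * (q + 1).negOnePow := by
    rw [ε, ε, ← Units.val_mul, ← Int.negOnePow_add, ← Units.val_mul, ← Int.negOnePow_add,
      Units.val_inj, Int.negOnePow_eq_iff, ← hq, show (q + 1) * (q + 1 + 1) = q * (q + 1) +
        (q + 1) * 2 by ring, Int.add_mul_ediv_right _ _ two_ne_zero]
    exact ⟨0, by ring⟩
  change (cap h z (δ Y hm g)).1 = (cap h₁ (d hp z) g).1 + (p.negOnePow : ℤ) • (d hq (cap h₂ z g)).1
  rw [cap_val _ hq0, cap_val _ hq0, d_val _ hq0, cap_val _ (by omega), d_val _ (by omega), e1, e2]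
  have key : (q.negOnePow : ℤ) • cap₀ q m' p z.1 (δ Y hm g).1 =
      cap₀ q m p' (bd p' p z.1) g.1 - bd q q' (cap₀ q' m p z.1 g.1) := by
    generalize z.1 = z
    induction z using Finsupp.induction_linear with
    | zero => simp
    | add x y hx hy => simp only [map_add, AddMonoidHom.add_apply, smul_add, hx, hy]; abel
    | single x r =>
      have eq : (q.negOnePow : ℤ) = (-1) ^ q.toNat := by
        lift q to ℕ using hq0; simp [Int.coe_negOnePow_natCast]
      have hr : p.toNat + 1 = q.toNat + 1 + (m.toNat + 1) := by omega
      have hm' : m'.toNat + 1 = m.toNat + 1 + 1 := by omega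
      have hq' : q'.toNat + 1 = q.toNat + 1 + 1 := by omega
      have hA : cap₀ q m p' (bd p' p (.single x r)) g.1 = ∑ j ∈ Finset.range (p.toNat + 1),
          (-1 : ℤ) ^ j • Finsupp.single (act OrderHom.id q (act (face j) p' x))
            (r * g.1 (act (back q.toNat) m (act (face j) p' x))) := by
        rw [bd_single, map_sum, AddMonoidHom.finsetSum_apply]
        refine Finset.sum_congr rfl fun j _ => ?_
        rw [map_zsmul, AddMonoidHom.smul_apply, cap₀_single]
      have hC : (q.negOnePow : ℤ) • cap₀ q m' p (.single x r) (δ Y hm g).1 =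
          ∑ l ∈ Finset.range (m'.toNat + 1), (-1 : ℤ) ^ (q.toNat + l) •
            Finsupp.single (act OrderHom.id q x)
              (r * g.1 (act (face l) m (act (back q.toNat) m' x))) := by
        rw [cap₀_single, eq]
        change (-1 : ℤ) ^ q.toNat • Finsupp.single (act OrderHom.id q x)
          (r * ∑ j ∈ Finset.range (m'.toNat + 1), _) = _
        rw [Finset.mul_sum, Finsupp.single_finsetSum, Finset.smul_sum]
        refine Finset.sum_congr rfl fun l _ => ?_
        rw [Finsupp.smul_single, Finsupp.smul_single, pow_add]
        congr 1
        simp only [smul_eq_mul]; ring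
      have a1 : ∀ j < q.toNat + 1, act OrderHom.id q (act (face j) p' x) =
          act (face j) q (act OrderHom.id q' x) := fun j hj => by
        rw [act_act _ _ (face j), act_act _ _ (face j)] <;>
        · intro i hi; simp only [face_apply, OrderHom.id_coe, id]; split_ifs <;> omega
      have a2 : ∀ j < q.toNat + 1, act (back q.toNat) m (act (face j) p' x) =
          act (back q'.toNat) m x := fun j hj => by
        rw [act_act _ _ (back q'.toNat)]
        intro i hi; simp only [face_apply, back_apply]; split_ifs <;> omega
      have a3 : ∀ l < m.toNat + 1, act OrderHom.id q (act (face (q.toNat + 1 + l)) p' x) =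
          act OrderHom.id q x := fun l hl => by
        rw [act_act _ _ OrderHom.id]
        intro i hi; simp only [face_apply, OrderHom.id_coe, id]; split_ifs <;> omega
      have a4 : ∀ l < m.toNat + 1, act (back q.toNat) m (act (face (q.toNat + 1 + l)) p' x) =
          act (face (l + 1)) m (act (back q.toNat) m' x) := fun l hl => by
        rw [act_act _ _ ((face (q.toNat + 1 + l)).comp (back q.toNat)),
          act_act _ _ ((face (q.toNat + 1 + l)).comp (back q.toNat))] <;>
        · intro i hi
          simp only [face_apply, back_apply, OrderHom.comp_coe, Function.comp]
          split_ifs <;> omega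
      have a5 : act (face (q.toNat + 1)) q (act OrderHom.id q' x) = act OrderHom.id q x := by
        rw [act_act _ _ OrderHom.id]
        intro i hi; simp only [face_apply, OrderHom.id_coe, id]; split_ifs <;> omega
      have a6 : act (face 0) m (act (back q.toNat) m' x) = act (back q'.toNat) m x := by
        rw [act_act _ _ (back q'.toNat)]
        intro i hi; simp only [face_apply, back_apply]; split_ifs <;> omega
      rw [hA, hC, cap₀_single, bd_single, hr, hm', hq', Finset.sum_range_add _ (q.toNat + 1),
        Finset.sum_range_succ _ (q.toNat + 1), add_sub_add_comm, ← Finset.sum_sub_distrib,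
        Finset.sum_eq_zero (s := Finset.range (q.toNat + 1)), zero_add, Finset.sum_range_succ',
        sub_eq_add_neg]
      · congr 1
        · refine Finset.sum_congr rfl fun j hj => ?_
          rw [Finset.mem_range] at hj
          rw [a3 j hj, a4 j hj, add_assoc, add_comm 1 j]
        · rw [a5, a6, pow_succ]; simp
      · intro j hj
        rw [Finset.mem_range] at hj
        rw [a1 j hj, a2 j hj, sub_self]
  have hqq : ((q + 1).negOnePow : ℤ) = - q.negOnePow := by simp [Int.negOnePow_succ]
  have hq1 : (q.negOnePow : ℤ) * q.negOnePow = 1 := by simp [← Units.val_mul]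
  have hp1 : (p.negOnePow : ℤ) * p.negOnePow = 1 := by simp [← Units.val_mul]
  rw [map_zsmul, hqq]
  generalize (q.negOnePow : ℤ) = a at *
  generalize (p.negOnePow : ℤ) = b at *
  rw [sub_eq_iff_eq_add.1 key.symm, smul_smul, smul_add, smul_smul, add_assoc, ← add_smul]
  rw [mul_assoc, hq1, show ε p q * a + b * (ε p q * b * -a) = ε p q * a * (1 - b * b) by ring, hp1]
  simp

end Simplicial

section Simplicial2

variable {X : SSet.{w}} (Y : X.Subcomplex)

/-- the simplices of `Y` as simplices of `X` -/
def incl {n : ℤ} (y : S Y.toSSet n) : S X n := y.1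

/-- a simplex of `X` that lies in `Y` as a simplex of `Y` -/
def mkY {n : ℤ} (x : S X n) (h : x ∈ Y.obj _) : S Y.toSSet n := ⟨x, h⟩

theorem incl_mem {n : ℤ} (y : S Y.toSSet n) : incl Y y ∈ Y.obj _ := y.2

theorem incl_inj {n : ℤ} : Function.Injective (incl Y (n := n)) := fun _ _ h => Subtype.ext h

theorem incl_act {a b : ℤ} (φ : ℕ →o ℕ) (y : S Y.toSSet a) :
    incl Y (act φ b y) = act φ b (incl Y y) := rfl

/-- The chains supported in `Y`. -/
def Supp (n : ℤ) : AddSubgroup (K X n) where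
  carrier := {z | ∀ x, x ∉ Y.obj _ → z.1 x = 0}
  add_mem' h h' x hx := by simp [h x hx, h' x hx]
  zero_mem' := by simp
  neg_mem' h x hx := by simp [h x hx]

/-- chains of `Y` as chains of `X` -/
def inclK (n : ℤ) : K Y.toSSet n →ₜ+ K X n :=
  ⟨((Finsupp.mapDomain.addMonoidHom (incl Y)).comp (KSub Y.toSSet n).subtype).codRestrict (KSub X n)
    fun z h => by simp [z.2 h], continuous_of_discreteTopology⟩

/-- a chain of `X` restricted to the simplices of `Y` -/
def resK {n : ℤ} (z : K X n) : K Y.toSSet n :=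
  ⟨z.1.comapDomain (incl Y) (incl_inj Y).injOn, fun h => by ext; simp [z.2 h]⟩

variable {Y}

theorem inclK_val {n : ℤ} (z : K Y.toSSet n) : (inclK Y n z).1 = z.1.mapDomain (incl Y) :=
  rfl

theorem inclK_inj {n : ℤ} : Function.Injective (inclK Y n) := fun z z' h => by
  have h := congrArg Subtype.val h
  rw [inclK_val, inclK_val] at h
  exact Subtype.ext (Finsupp.mapDomain_injective (incl_inj Y) h)

theorem inclK_mem {n : ℤ} (z : K Y.toSSet n) : inclK Y n z ∈ Supp Y n := fun x hx => by
  rw [inclK_val, Finsupp.mapDomain_of_notMem_range]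
  rintro ⟨y, rfl⟩
  exact hx (incl_mem Y y)

theorem inclK_resK {n : ℤ} {z : K X n} (h : z ∈ Supp Y n) : inclK Y n (resK Y z) = z := by
  refine Subtype.ext ?_
  rw [inclK_val]
  refine Finsupp.mapDomain_comapDomain _ (incl_inj Y) _ fun x hx => ?_
  by_contra h'
  exact Finsupp.mem_support_iff.1 hx (h x fun hY => h' ⟨⟨x, hY⟩, rfl⟩)

theorem inclK_d {a b : ℤ} (h : a + 1 = b) (z : K Y.toSSet b) :
    inclK Y a (d h z) = d h (inclK Y b z) := by
  ext1 ha
  rw [inclK_val, d_val _ ha, d_val _ ha, inclK_val]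
  generalize z.1 = z
  induction z using Finsupp.induction_linear with
  | zero => simp
  | add x y hx hy => simp_all [Finsupp.mapDomain_add]
  | single x r =>
    simp only [bd_single, Finsupp.mapDomain_single, Finsupp.mapDomain_finsetSum,
      Finsupp.mapDomain_smul, incl_act]

theorem cap_supp {p q m : ℤ} (h : q + m = p) {z : K X p} (hz : z ∈ Supp Y p) (g : L Y m) :
    cap h z g = 0 := by
  ext1 hq
  rw [cap_val _ hq]
  simp only [cap₀, Finsupp.liftAddHom_apply, Finsupp.sum, AddMonoidHom.finsetSum_apply]
  rw [Finset.sum_eq_zero, smul_zero]; rfl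
  intro x hx
  have hY : x ∈ Y.obj _ := by
    by_contra h'
    exact Finsupp.mem_support_iff.1 hx (hz x h')
  simp [g.2 _ (.inr (mem_act _ hY))]

open Classical in
/-- the extension by zero of a cochain of `Y` -/
def extL (n : ℤ) : L (⊥ : Y.toSSet.Subcomplex) n →ₜ+ L (⊥ : X.Subcomplex) n where
  toFun g := ⟨fun x => if hx : x ∈ Y.obj _ then g.1 (mkY Y x hx) else 0, fun x hx => by
    dsimp only
    split_ifs
    exacts [g.2 _ (hx.imp_right False.elim), rfl]⟩
  map_zero' := by ext; dsimp; split_ifs <;> rfl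
  map_add' g g' := by ext x; dsimp; split_ifs <;> simp
  continuous_toFun := by
    refine Continuous.subtype_mk (continuous_pi fun x => ?_) _
    by_cases hx : x ∈ Y.obj _
    · simp only [hx, dite_true]
      exact (continuous_apply _).comp continuous_subtype_val
    · simp only [hx, dite_false]
      exact continuous_const

open Classical in
/-- cochains cut off on `Y` -/
def cut (n : ℤ) : L (⊥ : X.Subcomplex) n →ₜ+ L Y n where
  toFun g := ⟨fun x => if x ∈ Y.obj _ then 0 else g.1 x, fun x hx => by
    dsimp only
    split_ifs with h
    exacts [rfl, g.2 x (.inl (hx.resolve_right h))]⟩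
  map_zero' := by ext; simp
  map_add' g g' := by ext x; dsimp; split_ifs <;> simp
  continuous_toFun := by
    refine Continuous.subtype_mk (continuous_pi fun x => ?_) _
    by_cases hx : x ∈ Y.obj _
    · simp only [hx, if_true]
      exact continuous_const
    · simp only [hx, if_false]
      exact (continuous_apply x).comp continuous_subtype_val

/-- The connecting operator: the coboundary of the extension by zero, cut off on `Y`. -/
def del {a b : ℤ} (h : a + 1 = b) : L (⊥ : Y.toSSet.Subcomplex) a →ₜ+ L Y b :=
  (cut b).comp ((δ ⊥ h).comp (extL a))

theorem δ_val {a b : ℤ} (h : a + 1 = b) (g : L Y a) (x : S X b) : (δ Y h g).1 x =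
    ∑ j ∈ Finset.range (b.toNat + 1), (-1) ^ j * g.1 (act (face j) a x) := rfl

theorem extL_pos {n : ℤ} (g : L (⊥ : Y.toSSet.Subcomplex) n) {x : S X n} (hx : x ∈ Y.obj _) :
    (extL n g).1 x = g.1 (mkY Y x hx) := dif_pos hx

theorem del_add {a b : ℤ} (h : a + 1 = b) (g : L (⊥ : Y.toSSet.Subcomplex) a) (x : S X b) :
    (del h g).1 x + (extL b (δ ⊥ h g)).1 x = (δ ⊥ h (extL a g)).1 x := by
  by_cases hx : x ∈ Y.obj _
  · rw [(del h g).2 x (.inr hx), zero_add, extL_pos _ hx, δ_val, δ_val]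
    refine Finset.sum_congr rfl fun j _ => ?_
    rw [extL_pos _ (mem_act _ hx)]; rfl
  · exact (congrArg₂ (· + ·) (if_neg hx) (dif_neg hx)).trans (add_zero _)

theorem δ_del {a b c : ℤ} (h : a + 1 = b) (h' : b + 1 = c) (g : L (⊥ : Y.toSSet.Subcomplex) a) :
    δ Y h' (del h g) = - del h' (δ ⊥ h g) := by
  rw [eq_neg_iff_add_eq_zero]
  ext x hc
  change (δ Y h' (del h g)).1 x + (del h' (δ ⊥ h g)).1 x = 0
  by_cases hx : x ∈ Y.obj _
  · rw [(δ Y h' (del h g)).2 x (.inr hx), (del h' (δ ⊥ h g)).2 x (.inr hx), add_zero]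
  · have e : (del h' (δ ⊥ h g)).1 x = (δ ⊥ h' (extL b (δ ⊥ h g))).1 x := if_neg hx
    have e2 : (δ ⊥ h' (δ ⊥ h (extL a g))).1 x = 0 := by rw [δδ]; rfl
    rw [e, ← e2, δ_val, δ_val, δ_val, ← Finset.sum_add_distrib]
    refine Finset.sum_congr rfl fun j _ => ?_
    rw [← del_add]; ring

end Simplicial2

/-- the multiple `(-1) ^ n • f` -/
def sgn (n : ℤ) {M N : Type w} [AddCommGroup M] [TopologicalSpace M] [AddCommGroup N]
    [TopologicalSpace N] [IsTopologicalAddGroup N] (f : M →ₜ+ N) : M →ₜ+ N where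
  toFun x := (n.negOnePow : ℤ) • f x
  map_zero' := by simp
  map_add' := by simp
  continuous_toFun := f.continuous.zsmul _

section Final

variable (X : SSet.{w}) (Y : X.Subcomplex)
variable (A : Type u) [Category.{v} A] [MonoidalCategory A] [SymmetricCategory A] [IsGroupoid A]

/-- The integral chains of `X` around degree `q`, which is placed at the index `2`. -/
abbrev chainCx (q : ℤ) : Cx.{w} where
  X i := K X (q - 2 + i)
  d i := d (by push_cast; ring)
  dd i x := dd _ _ x

variable {X}
/-- The integral cochains of `X` vanishing on `Y` around degree `m`, which is placed at the
index `2`. -/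
abbrev cochainCx (m : ℤ) : Cx.{w} where
  X i := L Y (m + 2 - i)
  d i := δ Y (by push_cast; ring)
  dd i x := δδ _ _ x

variable (X) in
/-- The cohomology `H^q(X; A)`. For a strictly commutative Picard groupoid `A` the additive functors
`ℤ[X_n] ⟶ A` are equivalent, by restriction to the basis, to the functions `X_n → A`, and the
differential is the alternating sum of the pullbacks along the face maps. -/
abbrev Cohomology (q : ℤ) := H (chainCx X q) A

/-- The homology `H_m(X, Y; A)`. For a strictly commutative Picard groupoid `A` the continuous additive
functors from the integral cochains of degree `n` of `X` that vanish on `Y`, with the topology of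
pointwise convergence, to `A` are equivalent to the `A`-valued functions on `X_n` of finite
support, modulo those supported on `Y_n`: a formal sum of `a_x x` corresponds to the functor that
takes `g` to the sum of the `g(x) a_x`. For `Y` empty this is `H_m(X; A)`. -/
abbrev Homology (m : ℤ) := H (cochainCx Y m) A

/-- Restriction of cochains to `Y`. -/
def resMap (q : ℤ) : CxMap (chainCx Y.toSSet q) (chainCx X q) where
  T i := inclK Y _
  comm i x := inclK_d (by push_cast; ring) x

theorem sgn_δ_del {a b b' c : ℤ} (n n' : ℤ) (hn : n' = n + 1) (h : a + 1 = b) (h₂ : a + 1 = b')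
    (h' : b + 1 = c) (h₂' : b' + 1 = c) (g : L (⊥ : Y.toSSet.Subcomplex) a) :
    sgn n (del h') (δ ⊥ h g) = δ Y h₂' (sgn n' (del h₂) g) := by
  obtain rfl : b = b' := h.symm.trans h₂
  change (n.negOnePow : ℤ) • del h' (δ ⊥ h g) = δ Y h' ((n'.negOnePow : ℤ) • del h g)
  rw [map_zsmul, δ_del h h', hn, Int.negOnePow_succ]
  simp

/-- The connecting map: dual to the one that takes a relative chain to the part in `Y` of its boundary. -/
def delMap (m : ℤ) : CxMap (cochainCx (⊥ : Y.toSSet.Subcomplex) m) (cochainCx Y (m + 1)) where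
  T i := sgn i (del (by ring))
  comm i x := sgn_δ_del Y i (i + 1 : ℕ) (by push_cast; ring) (by push_cast; ring)
    (by push_cast; ring) (by ring) (by push_cast; ring) x

variable {Y}

theorem cap_sub {p q m : ℤ} (h : q + m = p) (z z' : K X p) (g : L Y m) :
    cap h (z - z') g = cap h z g - cap h z' g := by
  rw [sub_eq_add_neg, cap_add, cap_neg, sub_eq_add_neg]

theorem sgn_cap {p q q' m m' : ℤ} (n n' : ℤ) (hn : n' = n + p) (hm : m + 1 = m') (hq : q + 1 = q')
    (h : q + m' = p) (h₂ : q' + m = p) {z : K X p}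
    (hz : ∀ (p' : ℤ) (hp : p' + 1 = p), d hp z ∈ Supp Y p') (g : L Y m) :
    sgn n (cap h z) (δ Y hm g) = d hq (sgn n' (cap h₂ z) g) := by
  change (n.negOnePow : ℤ) • cap h z (δ Y hm g) = d hq ((n'.negOnePow : ℤ) • cap h₂ z g)
  have e := cap_δ hm (sub_add_cancel p 1) hq h (by omega) h₂ z g
  rw [cap_supp _ (hz _ _), zero_add] at e
  rw [map_zsmul, e, smul_smul, hn, Int.negOnePow_add]
  simp

/-- The cap product with a relative cycle `z`, as a map of complexes. -/
def capMap {p q m : ℤ} (h : q + m = p) (z : K X p)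
    (hz : ∀ (p' : ℤ) (hp : p' + 1 = p), d hp z ∈ Supp Y p') :
    CxMap (cochainCx Y m) (chainCx X q) where
  T i := sgn (p * i) (cap (by rw [← h]; ring) z)
  comm i x := sgn_cap (p * i) (p * (i + 1 : ℕ)) (by push_cast; ring) (by push_cast; ring)
    (by push_cast; ring) (by rw [← h]; ring) (by rw [← h]; ring) hz x

theorem sgn_cap_htpy {p p₁ q q' m m' : ℤ} (n n' n₁ : ℤ) (hn : n = n₁) (hn' : n' = n + p)
    (hm : m + 1 = m') (hp : p + 1 = p₁) (hq : q + 1 = q')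
    (h : q + m = p) (h₁ : q + m' = p₁) (h₂ : q' + m = p₁) {z z' : K X p} {v : K X p₁}
    (hv : z - z' - d hp v ∈ Supp Y p) (g : L Y m) :
    d hq (sgn n' (cap h₂ v) g) + (sgn n (cap h₁ v) (δ Y hm g) + sgn n₁ (cap h z') g) =
      sgn n₁ (cap h z) g := by
  subst hn hn'
  change d hq (((n + p).negOnePow : ℤ) • cap h₂ v g) + ((n.negOnePow : ℤ) • cap h₁ v (δ Y hm g) +
    (n.negOnePow : ℤ) • cap h z' g) = (n.negOnePow : ℤ) • cap h z g
  have e := cap_δ hm hp hq h₁ h h₂ v g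
  have e' := cap_supp h hv g
  rw [cap_sub, cap_sub, sub_sub, sub_eq_zero] at e'
  have e3 : (p₁.negOnePow : ℤ) = - p.negOnePow := by rw [← hp, Int.negOnePow_succ]; simp
  rw [map_zsmul, e, e', e3, Int.negOnePow_add]
  simp only [Units.val_mul, neg_smul, smul_add, smul_neg, smul_smul]
  abel

/-- The homotopy given by a chain `v` with `z - z' - d v` in `Y`. -/
def capHtpy {p q m : ℤ} (h : q + m = p) {z z' : K X p} (hz hz') {v : K X (p + 1)}
    (hv : z - z' - d rfl v ∈ Supp Y p) :
    Htpy (capMap h z hz) (capMap (Y := Y) h z' hz') where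
  s i := sgn (p * (i + 1)) (cap (by rw [← h]; push_cast; ring) v)
  h i x := by
    refine sgn_cap_htpy (p * (i + 1)) (p * ((i + 1 : ℕ) + 1)) (p * (i + 1 : ℕ)) ?_ ?_ ?_ rfl ?_ ?_
      ?_ ?_ hv x <;> push_cast <;> (try rw [← h]) <;> ring

theorem sgn_cap_htpy2 {p₁ p q q' m m' : ℤ} (n n' n₁ : ℤ) (hn : n = n₁ + 1) (hn' : n' = n₁ + p₁)
    (hm : m + 1 = m') (hp : p₁ + 1 = p) (hq : q + 1 = q')
    (h : q + m = p₁) (h₁ : q + m' = p) (h₂ : q' + m = p) {v v' : K X p₁} {w : K X p}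
    (hw : v - v' - d hp w ∈ Supp Y p₁) (g : L Y m) :
    d hq (sgn n' (cap h₂ w) g) + (sgn n₁ (cap h v') g - sgn n (cap h₁ w) (δ Y hm g)) =
      sgn n₁ (cap h v) g := by
  subst hn hn'
  change d hq (((n₁ + p₁).negOnePow : ℤ) • cap h₂ w g) + ((n₁.negOnePow : ℤ) • cap h v' g -
    ((n₁ + 1).negOnePow : ℤ) • cap h₁ w (δ Y hm g)) = (n₁.negOnePow : ℤ) • cap h v g
  have e := cap_δ hm hp hq h₁ h h₂ w g
  have e' := cap_supp h hw g
  rw [cap_sub, cap_sub, sub_sub, sub_eq_zero] at e'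
  have e3 : (p.negOnePow : ℤ) = - p₁.negOnePow := by rw [← hp, Int.negOnePow_succ]; simp
  rw [map_zsmul, e, e', e3, Int.negOnePow_add, Int.negOnePow_succ]
  simp only [Units.val_mul, Units.val_neg, neg_smul, smul_add, smul_neg, smul_smul, neg_mul]
  abel

/-- The homotopy given by a chain `w` with `v - v' - d w` in `Y`. -/
def capHtpy2 {p q m : ℤ} (h : q + m = p) {z z' : K X p} (hz hz') {v v' : K X (p + 1)}
    (hv : z - z' - d rfl v ∈ Supp Y p) (hv' : z - z' - d rfl v' ∈ Supp Y p) {w : K X (p + 1 + 1)}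
    (hw : v - v' - d rfl w ∈ Supp Y (p + 1)) :
    Htpy2 (capHtpy (q := q) (m := m) h hz hz' hv) (capHtpy h hz hz' hv') where
  t i := sgn (p * (i + 2) + 1) (cap (by rw [← h]; push_cast; ring) w)
  h i x := by
    refine sgn_cap_htpy2 (p * (i + 2) + 1) (p * ((i + 1 : ℕ) + 2) + 1) (p * ((i + 1 : ℕ) + 1)) ?_ ?_ ?_ rfl ?_ ?_
      ?_ ?_ hw x <;> push_cast <;> (try rw [← h]) <;> ring

end Final

section Integral

variable {X : SSet.{w}} (Y : X.Subcomplex)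

/-- The objects of the homology groupoid `H_p(X, Y; ℤ[0])`. The cokernel of `ℤ[Y_n] ⟶ ℤ[X_n]` in Picard
groupoids has the chains of `X` as objects, and the chains of `Y` as morphisms; so an object is a
chain of `X` with boundary in `Y`. -/
structure IntHomology (p : ℤ) where
  z : K X p
  hz : ∀ (p' : ℤ) (hp : p' + 1 = p), d hp z ∈ Supp Y p'

namespace IntHomology
variable {Y} {p : ℤ}

/-- Representatives of morphisms `z ⟶ z'`: chains `v` with `z = d v + z'` modulo chains of `Y`. -/
@[ext] structure Pre (z z' : IntHomology Y p) where
  v : K X (p + 1)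
  hv : z.z - z'.z - d rfl v ∈ Supp Y p

/-- The equivalence of representatives: `v = d w + v'` modulo chains of `Y`. -/
def Rel {z z' : IntHomology Y p} (v v' : Pre z z') : Prop :=
  ∃ w : K X (p + 1 + 1), v.v - v'.v - d rfl w ∈ Supp Y (p + 1)

/-- the identity representative -/
def Pre.id (z : IntHomology Y p) : Pre z z := ⟨0, by simp⟩

/-- composition of representatives -/
def Pre.comp {z z' z'' : IntHomology Y p} (v : Pre z z') (v' : Pre z' z'') : Pre z z'' :=
  ⟨v.v + v'.v, by convert add_mem v.hv v'.hv using 1; rw [map_add]; abel⟩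

instance : Category (IntHomology Y p) where
  Hom z z' := Quot (Rel (z := z) (z' := z'))
  id z := Quot.mk _ (Pre.id z)
  comp := Quot.map₂ Pre.comp
    (fun v v' v'' ⟨w, h⟩ => ⟨w, by
      convert h using 1; change v.v + v'.v - (v.v + v''.v) - _ = _; abel⟩)
    (fun v v' v'' ⟨w, h⟩ => ⟨w, by
      convert h using 1; change v.v + v''.v - (v'.v + v''.v) - _ = _; abel⟩)
  id_comp := by rintro _ _ ⟨v⟩; exact congrArg _ (Pre.ext (zero_add _))
  comp_id := by rintro _ _ ⟨v⟩; exact congrArg _ (Pre.ext (add_zero _))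
  assoc := by rintro _ _ _ _ ⟨v⟩ ⟨v'⟩ ⟨v''⟩; exact congrArg _ (Pre.ext (add_assoc _ _ _))

/-- the class of a relative homology -/
abbrev homMk {z z' : IntHomology Y p} (v : K X (p + 1)) (hv : z.z - z'.z - d rfl v ∈ Supp Y p) : z ⟶ z' :=
  Quot.mk _ ⟨v, hv⟩

/-- the sum of two relative cycles -/
def add (z e : IntHomology Y p) : IntHomology Y p :=
  ⟨z.z + e.z, fun p' hp => by rw [map_add]; exact add_mem (z.hz _ _) (e.hz _ _)⟩

/-- the sum of two morphisms -/
def addHom {z z' e e' : IntHomology Y p} : (z ⟶ z') → (e ⟶ e') → (z.add e ⟶ z'.add e') :=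
  Quot.map₂ (fun v v' => ⟨v.v + v'.v, by
      convert add_mem v.hv v'.hv using 1; rw [map_add]; change z.z + e.z - (z'.z + e'.z) - _ = _; abel⟩)
    (fun v v' v'' ⟨w, h⟩ => ⟨w, by
      convert h using 1; change v.v + v'.v - (v.v + v''.v) - _ = _; abel⟩)
    (fun v v' v'' ⟨w, h⟩ => ⟨w, by
      convert h using 1; change v.v + v''.v - (v'.v + v''.v) - _ = _; abel⟩)

end IntHomology

variable {Y}

/-- The connecting functor `∂ : H_{p + 1}(X, Y; ℤ[0]) ⥤ H_p(Y; ℤ[0])`. -/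
def bdry (p : ℤ) : IntHomology Y (p + 1) ⥤ IntHomology (⊥ : Y.toSSet.Subcomplex) p where
  obj z := ⟨resK Y (d rfl z.z), fun p' hp => by
    have e : d hp (resK Y (d rfl z.z)) = 0 := inclK_inj (by
      rw [inclK_d, inclK_resK (z.hz _ _), dd, map_zero])
    rw [e]; exact zero_mem _⟩
  map {z z'} := Quot.map (fun v => ⟨resK Y (z.z - z'.z - d rfl v.v), by
      have e : resK Y (d rfl z.z) - resK Y (d rfl z'.z) -
          d rfl (resK Y (z.z - z'.z - d rfl v.v)) = 0 := inclK_inj (by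
        simp only [map_sub, inclK_d, inclK_resK (z.hz _ _), inclK_resK (z'.hz _ _),
          inclK_resK v.hv, dd, map_zero]
        abel)
      rw [e]; exact zero_mem _⟩)
    fun v v' ⟨w, hw⟩ => ⟨-resK Y (v.v - v'.v - d rfl w), by
      have e : resK Y (z.z - z'.z - d rfl v.v) - resK Y (z.z - z'.z - d rfl v'.v) -
          d rfl (-resK Y (v.v - v'.v - d rfl w)) = 0 := inclK_inj (by
        simp only [map_sub, map_neg, inclK_d, inclK_resK v.hv, inclK_resK v'.hv, inclK_resK hw, dd,
          map_zero]
        abel)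
      rw [e]; exact zero_mem _⟩
  map_id z := congrArg (Quot.mk _) (IntHomology.Pre.ext (inclK_inj (by
    rw [inclK_resK (IntHomology.Pre.id z).hv]; change z.z - z.z - d rfl 0 = inclK Y _ 0; simp)))
  map_comp := by
    rintro z z' z'' ⟨v⟩ ⟨v'⟩
    refine congrArg (Quot.mk _) (IntHomology.Pre.ext (inclK_inj ?_))
    change _ = inclK Y _ (resK Y (z.z - z'.z - d rfl v.v) + resK Y (z'.z - z''.z - d rfl v'.v))
    rw [map_add, inclK_resK (v.comp v').hv, inclK_resK v.hv, inclK_resK v'.hv]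
    change z.z - z''.z - d rfl (v.v + v'.v) = _
    rw [map_add]; abel

/-- The connecting functor on integral homology is additive. -/
def bdryAdd (p : ℤ) (z e : IntHomology Y (p + 1)) :
    ((bdry p).obj z).add ((bdry p).obj e) ⟶ (bdry p).obj (z.add e) :=
  IntHomology.homMk 0 (by
    have e' : resK Y (d rfl z.z) + resK Y (d rfl e.z) - resK Y (d rfl (z.z + e.z)) - d rfl 0 = 0 :=
      inclK_inj (by
        have := inclK_resK ((z.add e).hz p rfl)
        rw [map_zero, sub_zero, map_sub, map_add, inclK_resK (z.hz _ _), inclK_resK (e.hz _ _), map_zero,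
          ← map_add, sub_eq_zero]
        exact this.symm)
    exact e' ▸ zero_mem _)

end Integral

section Functors

variable {X : SSet.{w}} {Y : X.Subcomplex}
variable (A : Type u) [Category.{v} A] [MonoidalCategory A] [SymmetricCategory A] [IsGroupoid A]

/-- The restriction `i^* : H^q(X; A) ⥤ H^q(Y; A)`. -/
def restr (Y : X.Subcomplex) (q : ℤ) : Cohomology X A q ⥤ Cohomology Y.toSSet A q :=
  H.map (resMap Y q)

/-- The restriction is additive. -/
def restrAdd (Y : X.Subcomplex) (q : ℤ) (F G : Cohomology X A q) :
    H.add ((restr A Y q).obj F) ((restr A Y q).obj G) ⟶ (restr A Y q).obj (H.add F G) :=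
  (H.mapAdd (resMap Y q) F G).hom

/-- The connecting functor `∂ : H_{m + 1}(X, Y; A) ⥤ H_m(Y; A)`. -/
def conn (Y : X.Subcomplex) (m : ℤ) :
    Homology Y A (m + 1) ⥤ Homology (⊥ : Y.toSSet.Subcomplex) A m :=
  H.map (delMap Y m)

/-- The connecting functor is additive. -/
def connAdd (Y : X.Subcomplex) (m : ℤ) (c e : Homology Y A (m + 1)) :
    H.add ((conn A Y m).obj c) ((conn A Y m).obj e) ⟶ (conn A Y m).obj (H.add c e) :=
  (H.mapAdd (delMap Y m) c e).hom

variable {p q m : ℤ} (h : q + m = p)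

/-- The cap product `z ∩ F` with a fixed object `z`, as a functor in `F`. -/
def capProd (z : IntHomology Y p) : Cohomology X A q ⥤ Homology Y A m :=
  H.map (capMap h z.z z.hz)

/-- The cap product is additive in the second variable: `z ∩ F + z ∩ G ⟶ z ∩ (F + G)`. -/
def capProdAddRight (z : IntHomology Y p) (F G : Cohomology X A q) :
    H.add ((capProd A h z).obj F) ((capProd A h z).obj G) ⟶ (capProd A h z).obj (H.add F G) :=
  (H.mapAdd (capMap h z.z z.hz) F G).hom

variable {A}

/-- The cap product `f ∩ F : z ∩ F ⟶ z' ∩ F` of a morphism `f : z ⟶ z'` and an object `F`. -/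
def capProdMapLeft {z z' : IntHomology Y p} (f : z ⟶ z') (F : Cohomology X A q) :
    (capProd A h z).obj F ⟶ (capProd A h z').obj F :=
  Quot.map (fun v => H.htpyPre (capHtpy h z.hz z'.hz v.hv) F)
    (fun v v' ⟨_, hw⟩ => H.htpyPre_rel (capHtpy2 h z.hz z'.hz v.hv v'.hv hw) F) f

/-- The cap product is additive in the first variable: `z ∩ F + e ∩ F ⟶ (z + e) ∩ F`. -/
def capProdAddLeft (z e : IntHomology Y p) (F : Cohomology X A q) :
    H.add ((capProd A h z).obj F) ((capProd A h e).obj F) ⟶ (capProd A h (z.add e)).obj F :=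
  H.mapSum (fun _ _ => (smul_add _ _ _).symm.trans (congrArg _ (cap_add _ _ _ _).symm)) F

end Functors

end PicCoh

end

open PicCoh

/-!
The cap product, the restriction and the connecting functors are all induced by maps of complexes of
topological abelian groups, by precomposition of additive functors. Both ways around the square are
thus induced by maps from the cochain complex of `Y` to the chain complex of `X`: the first sends a
cochain `g` of `Y` to `± z ∩ del g`, where `del g` is the coboundary of the extension `g'` of `g` by
zero, cut off on `Y`; the second sends it to `± ∂z ∩ g'`. The boundary formula for the cap product
says
  `z ∩ δ g' = ∂z ∩ g' ± ∂(z ∩ g')`,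
and `δ g' - del g` is the extension by zero of `δ g`. So the operators `g ↦ ± z ∩ g'` form a homotopy
between the two maps (`connHtpy`).

A homotopy between maps of complexes induces an isomorphism between the induced functors on
cohomology groupoids (`H.htpyIso`), which gives the required isomorphism. Its compatibilities follow
from general properties of this construction:
* it is natural in the object (`H.htpy_natural`), hence so is the isomorphism in `F`;
* it takes composites and compositions with maps of complexes to composites (`H.htpy_trans`,
  `H.map_htpy`, `H.htpy_map`) and depends only on the homotopy class of the homotopy
  (`H.htpyPre_rel`). For a relative homology `v` from `z` to `z'` the homotopy between homotopies that
  naturality in `z` requires is `g ↦ ± v ∩ g'` (`connHtpy2`), again by the boundary formula;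
* it is additive in the object (`H.addHom_htpy`) and in the homotopy (`H.mapSum_htpy`), hence the
  isomorphism is additive in `F` and in `z`.
-/

namespace PicCoh

noncomputable section

variable {M N P : Cx.{w}} {A : Type u} [Category.{v} A] [MonoidalCategory A] [SymmetricCategory A]
  [IsGroupoid A]

/-- The composite of maps of complexes. -/
def CxMap.comp (S : CxMap N P) (T : CxMap M N) : CxMap M P where
  T i := (S.T i).comp (T.T i)
  comm i x := (congrArg (S.T i) (T.comm i x)).trans (S.comm i _)

namespace AddFun

variable {M : Type w} [AddCommGroup M] [TopologicalSpace M]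
  {N : Type w'} [AddCommGroup N] [TopologicalSpace N]

/-- The isomorphism from the pullback along a zero homomorphism to zero. -/
abbrev pullZero {f : N →ₜ+ M} (h : ∀ x, f x = 0) (F : AddFun M A) : F.pull f ⟶ 𝟙_ _ where
  app x := F.counit (h x)
  app_unit _ := F.unit_counit _ _
  app_add _ := (F.add_counit _ _ _ _).symm
  cont := by
    have e : ∀ {x : M} (hx : x = 0), Arrow.mk (F.counit hx) = Arrow.mk (F.counit rfl) := by
      rintro x rfl; rfl
    unfold LC
    simp only [e]
    exact IsLocallyConstant.const _

omit [IsGroupoid A] in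
theorem add_tr (F : AddFun M A) {x y z z' : M} (h : x + y = z) (e : z = z') :
    F.add h ≫ F.tr e = F.add (h.trans e) := by subst e; exact Category.comp_id _

theorem add_eq_of_eq_zero (F : AddFun M A) {q r k : M} (hq : q = 0) (h : q + r = k) (e : r = k) :
    F.add h = (F.counit hq ▷ _) ≫ (λ_ _).hom ≫ F.tr e := by
  subst e
  have e := F.inv_add_counit hq h rfl
  rw [← cancel_epi (inv (F.add h)), reassoc_of% e]
  simp

end AddFun

/-! ### Representatives of morphisms -/

namespace H

/-- An isomorphism of the coboundary parts identifies two representatives; this is the case `c = 0`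
of the equivalence relation. -/
theorem mk_eq {a a' : H M A} {p q : Pre a a'} (g : p.b ⟶ q.b)
    (h : ∀ x, p.f.app x ≫ (g.app (M.d 1 x) ▷ _) = q.f.app x) :
    (Quot.mk _ p : a ⟶ a') = Quot.mk _ q :=
  Quot.sound (Pre.rel_of g h)

/-- A representative preceded by a morphism of cocycles. -/
abbrev Pre.precomp {a₀ a a' : H M A} (f : a₀.F ⟶ a.F)
    (h : ∀ x : M.X 3, f.app (M.d 2 x) ≫ a.φ.app x = a₀.φ.app x) (p : Pre a a') : Pre a₀ a' where
  b := p.b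
  f := f ≫ p.f
  comm x := by rw [← h, ← p.comm]; simp

/-- A representative followed by a morphism of cocycles. -/
abbrev Pre.postcomp {a a' a₁ : H M A} (p : Pre a a') (f : a'.F ⟶ a₁.F)
    (h : ∀ x : M.X 3, f.app (M.d 2 x) ≫ a₁.φ.app x = a'.φ.app x) : Pre a a₁ where
  b := p.b
  f := p.f ≫ (_ ◁ f)
  comm x := by
    rw [← p.comm, ← h]
    simp [whisker_exchange_assoc]

theorem ofHom_comp_mk {a₀ a a' : H M A} (f : a₀.F ⟶ a.F) (h) (p : Pre a a') :
    ofHom f h ≫ (Quot.mk _ p : a ⟶ a') = Quot.mk _ (p.precomp f h) :=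
  Quot.sound (Pre.rel_of (λ_ _).hom fun x => by simp)

theorem mk_comp_ofHom {a a' a₁ : H M A} (p : Pre a a') (f : a'.F ⟶ a₁.F) (h) :
    (Quot.mk _ p : a ⟶ a') ≫ ofHom f h = Quot.mk _ (p.postcomp f h) :=
  Quot.sound (Pre.rel_of (ρ_ _).hom fun x => by simp)

/-- `H` is contravariantly functorial up to this isomorphism, which is the identity on the
underlying additive functors. -/
def mapComp (S : CxMap N P) (T : CxMap M N) (a : H P A) :
    (map T).obj ((map S).obj a) ≅ (map (S.comp T)).obj a :=
  ofIso (Iso.refl _) fun x => by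
    -- The elements that a map of complexes makes equal are generalized, so that the transports
    -- along these equalities can be eliminated; the same device recurs below.
    have key : ∀ {x : P.X 3} {y z : P.X 2} (hy : z = P.d 2 x) (hz : y = z),
      𝟙 _ ≫ a.F.tr (hz.trans hy) ≫ a.φ.app x = a.F.tr hz ≫ a.F.tr hy ≫ a.φ.app x := by
      intro x y z hy hz; simp
    exact key (S.comm 2 (T.T 3 x)) (congrArg (S.T 2) (T.comm 2 x))

theorem mapComp_natural (S : CxMap N P) (T : CxMap M N) {a a' : H P A} (f : a ⟶ a') :
    (map T).map ((map S).map f) ≫ (mapComp S T a').hom =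
      (mapComp S T a).hom ≫ (map (S.comp T)).map f := by
  obtain ⟨p⟩ := f
  refine (mk_comp_ofHom (mapPre T (mapPre S p)) _ _).trans
    (Eq.trans ?_ (ofHom_comp_mk _ _ (mapPre (S.comp T) p)).symm)
  refine mk_eq (by exact 𝟙 (mapPre (S.comp T) p).b) fun x => ?_
  have key : ∀ {y : P.X 2} {z z' : P.X 1} (hz : P.d 1 y = z) (hz' : z = z') (h : P.d 1 y = z'),
      (((p.f.app y ≫ (p.b.tr hz ⊗ₘ 𝟙 _)) ≫ (p.b.tr hz' ⊗ₘ 𝟙 _)) ≫ (𝟙 (p.b.obj z') ⊗ₘ 𝟙 _)) ≫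
        (𝟙 (p.b.obj z') ▷ _) = 𝟙 _ ≫ p.f.app y ≫ (p.b.tr h ⊗ₘ 𝟙 _) := by
    intro y z z' hz hz' h
    subst hz hz'; simp
  exact key (S.comm 1 (T.T 2 x)).symm (congrArg (S.T 1) (T.comm 1 x).symm)
    ((S.comp T).comm 1 x).symm


/-- The isomorphism `F T ⟶ F T'` given by a homotopy between `T` and `T'`. -/
abbrev htpy {T T' : CxMap M N} (s : Htpy T T') (a : H N A) : (map T).obj a ⟶ (map T').obj a :=
  Quot.mk _ (htpyPre s a)

end H

/-! ### Operations on homotopies -/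

/-- A homotopy restricted along a map of complexes. -/
def Htpy.precomp {S S' : CxMap N P} (s : Htpy S S') (T : CxMap M N) :
    Htpy (S.comp T) (S'.comp T) where
  s i := (s.s i).comp (T.T i)
  h i x := by
    change P.d (i + 1) (s.s (i + 1) (T.T (i + 1) x)) + (s.s i (T.T i (M.d i x)) +
      S'.T (i + 1) (T.T (i + 1) x)) = S.T (i + 1) (T.T (i + 1) x)
    rw [T.comm, s.h]

/-- A homotopy followed by a map of complexes. -/
def Htpy.postcomp {T T' : CxMap M N} (s : Htpy T T') (S : CxMap N P) :
    Htpy (S.comp T) (S.comp T') where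
  s i := (S.T (i + 1)).comp (s.s i)
  h i x := by
    change P.d (i + 1) (S.T (i + 1 + 1) (s.s (i + 1) x)) + (S.T (i + 1) (s.s i (M.d i x)) +
      S.T (i + 1) (T'.T (i + 1) x)) = S.T (i + 1) (T.T (i + 1) x)
    rw [← S.comm, ← map_add, ← map_add, s.h]

/-- The sum of two composable homotopies. -/
def Htpy.trans {T T' T'' : CxMap M N} (s : Htpy T T') (s' : Htpy T' T'') : Htpy T T'' where
  s i := s.s i + s'.s i
  h i x := by
    change N.d (i + 1) (s.s (i + 1) x + s'.s (i + 1) x) + (s.s i (M.d i x) + s'.s i (M.d i x) +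
      T''.T (i + 1) x) = _
    rw [← s.h, ← s'.h, map_add]
    abel

/-- The inverse homotopy. -/
def Htpy.symm {T T' : CxMap M N} (s : Htpy T T') : Htpy T' T where
  s i := - s.s i
  h i x := by
    change N.d (i + 1) (- s.s (i + 1) x) + (- s.s i (M.d i x) + T.T (i + 1) x) = _
    rw [← s.h, map_neg]
    abel

/-! ### The action of homotopies on cohomology -/

namespace H

theorem sh_tr (a : H M A) {u : M.X 3} {x y y' : M.X 2} (h : M.d 2 u + y = x) (e : y = y') :
    a.sh u h ≫ a.F.tr e = a.sh u (e ▸ h) := by subst e; simp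

/-- The isomorphism `F(x) ⟶ F(d u + (y + z)) ⟶ F(y) + F(z)`, by which homotopies act. -/
def spl (a : H M A) (u : M.X 3) {x y z : M.X 2} (h : M.d 2 u + (y + z) = x) :
    a.F.obj x ⟶ a.F.obj y ⊗ a.F.obj z := a.sh u h ≫ inv (a.F.add rfl)

theorem spl_add (a : H M A) {u : M.X 3} {x y z : M.X 2} (h : M.d 2 u + (y + z) = x) {k : M.X 2}
    (hk : y + z = k) : a.spl u h ≫ a.F.add hk = a.sh u (hk ▸ h) := by
  subst hk; simp [spl]

/-- `spl u` is characterized by its composite with the addition. -/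
theorem eq_spl (a : H M A) {u : M.X 3} {x y z : M.X 2} (h : M.d 2 u + (y + z) = x)
    (f : a.F.obj x ⟶ a.F.obj y ⊗ a.F.obj z) {k : M.X 2} (hk : y + z = k)
    (hf : f ≫ a.F.add hk = a.sh u (hk ▸ h)) : f = a.spl u h := by
  subst hk; rw [spl, IsIso.eq_comp_inv, hf]

/-- `sh u` is compatible with adding an object on the left. -/
theorem add_sh_right (a : H M A) (u : M.X 3) {x y z x' y' : M.X 2} (h : M.d 2 u + y = x)
    (hx : z + x = x') (hy : z + y = y') (h' : M.d 2 u + y' = x') :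
    a.F.add hx ≫ a.sh u h' = (_ ◁ a.sh u h) ≫ a.F.add hy := by
  rw [← a.F.add_comm hx ((add_comm x z).trans hx), Category.assoc,
    a.add_sh' u h _ ((add_comm y z).trans hy) h', ← BraidedCategory.braiding_naturality_right_assoc,
    a.F.add_comm]

/-- The functor induced by `T` takes the isomorphism of a homotopy to the one of its restriction
along `T`. -/
theorem map_htpy {S S' : CxMap N P} (s : Htpy S S') (T : CxMap M N) (a : H P A) :
    (map T).map (htpy s a) ≫ (mapComp S' T a).hom =
      (mapComp S T a).hom ≫ htpy (s.precomp T) a := by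
  refine (mk_comp_ofHom (mapPre T (htpyPre s a)) _ _).trans
    (Eq.trans ?_ (ofHom_comp_mk _ _ (htpyPre (s.precomp T) a)).symm)
  refine mk_eq (by exact 𝟙 (htpyPre (s.precomp T) a).b) fun x => ?_
  have key : ∀ {u : P.X 3} {y z z' r : P.X 2} (h : P.d 2 u + (z + r) = y) (hz : z = z')
      (h' : P.d 2 u + (z' + r) = y),
      ((a.spl u h ≫ (a.F.tr hz ⊗ₘ 𝟙 (a.F.obj r))) ≫ (𝟙 (a.F.obj z') ⊗ₘ 𝟙 _)) ≫
        (𝟙 (a.F.obj z') ▷ _) = 𝟙 _ ≫ a.spl u h' := by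
    intro u y z z' r h hz h'
    subst hz; simp
  exact key (s.h 1 (T.T 2 x)) (congrArg (s.s 1) (T.comm 1 x).symm) ((s.precomp T).h 1 x)

/-- The isomorphism of a homotopy at an object induced by `S` is the one of the homotopy followed
by `S`. -/
theorem htpy_map {T T' : CxMap M N} (s : Htpy T T') (S : CxMap N P) (a : H P A) :
    htpy s ((map S).obj a) ≫ (mapComp S T' a).hom =
      (mapComp S T a).hom ≫ htpy (s.postcomp S) a := by
  refine (mk_comp_ofHom (htpyPre s ((map S).obj a)) _ _).trans
    (Eq.trans ?_ (ofHom_comp_mk _ _ (htpyPre (s.postcomp S) a)).symm)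
  refine mk_eq (by exact 𝟙 (htpyPre (s.postcomp S) a).b) fun x => ?_
  have key : ∀ {u : P.X 3} {t x y z k : P.X 2} (ht : t = P.d 2 u) (h₁ : t + k = x)
      (h₂ : y + z = k) (h : P.d 2 u + (y + z) = x),
      (((inv (a.F.add h₁) ≫ ((a.F.tr ht ≫ a.φ.app u) ⊗ₘ 𝟙 _) ≫ (λ_ _).hom) ≫ inv (a.F.add h₂)) ≫
        (𝟙 (a.F.obj y) ⊗ₘ 𝟙 _)) ≫ (𝟙 (a.F.obj y) ▷ _) = 𝟙 _ ≫ a.spl u h := by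
    intro u t x y z k ht h₁ h₂ h
    subst ht h₂; simp [spl, sh]
  exact key (S.comm 2 (s.s 2 x)) _ _ ((s.postcomp S).h 1 x)

theorem htpy_trans {T T' T'' : CxMap M N} (s : Htpy T T') (s' : Htpy T' T'') (a : H N A) :
    htpy s a ≫ htpy s' a = htpy (s.trans s') a := by
  refine mk_eq (p := (htpyPre s a).comp (htpyPre s' a))
    (AddFun.pullAdd (f := s.s 1) (g := s'.s 1) (fun x => rfl) a.F) fun x => ?_
  have key : ∀ {u u' v : N.X 3} {x y z y' z' w : N.X 2} (h : N.d 2 u + (y + z) = x)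
      (h' : N.d 2 u' + (y' + z') = z) (hv : u + u' = v) (hw : y + y' = w)
      (h'' : N.d 2 v + (w + z') = x),
      (a.spl u h ≫ (𝟙 _ ⊗ₘ a.spl u' h') ≫ (α_ _ _ _).inv) ≫ (a.F.add hw ▷ _) = a.spl v h'' := by
    intro u u' v x y z y' z' w h h' hv hw h''
    refine a.eq_spl h'' _ rfl ?_
    have hy : y + (y' + z') = w + z' := by rw [← hw, add_assoc]
    have e := a.F.add_assoc hw rfl rfl hy
    have e' := a.spl_add h' rfl
    rw [Category.assoc, e, Category.assoc, Category.assoc, Iso.inv_hom_id_assoc, id_tensorHom,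
      ← whiskerLeft_comp_assoc, e', ← a.add_sh_right u' h' rfl hy
        (by rw [← hy, ← h', add_left_comm]), ← Category.assoc, a.spl_add h rfl]
    exact a.sh_sh _ _ _ hv
  exact key (s.h 1 x) (s'.h 1 x) rfl (by exact rfl) ((s.trans s').h 1 x)

theorem htpy_eq {T T' : CxMap M N} (s s' : Htpy T T') (t : Htpy2 s s') (a : H N A) :
    htpy s a = htpy s' a := Quot.sound (htpyPre_rel t a)

/-- The homotopy with zero operators acts as the identity: `F(0) ≅ 0` trivializes the coboundary
part of its representative. -/
theorem htpy_self {T : CxMap M N} (s : Htpy T T) (hs : ∀ i x, s.s i x = 0) (a : H N A) :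
    htpy s a = 𝟙 _ := by
  refine mk_eq (p := htpyPre s a) (q := Pre.id _) (AddFun.pullZero (hs 1) a.F) fun x => ?_
  have key : ∀ {u : N.X 3} {x y : N.X 2} (h : N.d 2 u + (y + x) = x) (hu : u = 0) (hy : y = 0),
      a.spl u h ≫ (a.F.counit hy ▷ _) = (λ_ _).inv := by
    intro u x y h hu hy
    have e : y + x = x := by rw [hy, zero_add]
    rw [← cancel_mono (λ_ _).hom, spl, Category.assoc, Category.assoc,
      a.F.inv_add_counit hy rfl e, sh_tr, a.sh_zero (w := 0) _ (by rw [hu, map_zero]) rfl]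
    simp
  exact key (s.h 1 x) (hs 2 x) _

omit [IsGroupoid A] in
/-- Contraction of the first summands of two sums commutes with the interchange. -/
theorem tensorμ_contract {B B' X X' : A} (e : B ⟶ 𝟙_ A) (f : X ⟶ 𝟙_ A) :
    tensorμ B X B' X' ≫ (((e ▷ B') ≫ (λ_ _).hom) ⊗ₘ ((f ▷ X') ≫ (λ_ _).hom)) =
      (((e ▷ X) ≫ (λ_ _).hom ≫ f) ▷ (B' ⊗ X')) ≫ (λ_ _).hom := by
  have h := tensorμ_natural e f (𝟙 B') (𝟙 X')
  rw [id_tensorHom_id, tensorHom_id, tensorHom_id, tensorHom_id] at h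
  have h' := leftUnitor_naturality f
  rw [← tensorHom_comp_tensorHom, ← reassoc_of% h, ← h', tensor_left_unitality B' X',
    MonoidalCategory.tensorHom_def e f]
  simp only [comp_whiskerRight, Category.assoc]
  simp only [← comp_whiskerRight_assoc]
  simp

/-- The components of the natural transformation underlying a representative. -/
def Pre.app {a a' : H M A} (r : Pre a a') (x : M.X 2) :
    a.F.obj x ⟶ r.b.obj (M.d 1 x) ⊗ a'.F.obj x := r.f.app x

theorem Pre.app_add {a a' : H M A} (r : Pre a a') {x y z : M.X 2} (h : x + y = z)
    (h' : M.d 1 x + M.d 1 y = M.d 1 z) :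
    (r.app x ⊗ₘ r.app y) ≫ tensorμ _ _ _ _ ≫ (r.b.add h' ⊗ₘ a'.F.add h) =
      a.F.add h ≫ r.app z := r.f.app_add h

theorem Pre.app_d {a a' : H M A} (r : Pre a a') (u : M.X 3) :
    r.app (M.d 2 u) ≫ (r.b.counit (M.dd 1 u) ▷ _) ≫ (λ_ _).hom ≫ a'.φ.app u = a.φ.app u :=
  r.comm u

/-- A morphism of cocycles up to the coboundary of `b` commutes with the isomorphisms `sh`. -/
theorem Pre.sh_app {a a' : H M A} (r : Pre a a') {u : M.X 3} {x y : M.X 2}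
    (h : M.d 2 u + y = x) (e : M.d 1 y = M.d 1 x) :
    a.sh u h ≫ r.app y ≫ (r.b.tr e ▷ _) = r.app x ≫ (_ ◁ a'.sh u h) := by
  have h0 : M.d 1 (M.d 2 u) + M.d 1 y = M.d 1 x := by rw [← map_add, h]
  have h1 := r.app_add h h0
  have h2 := r.b.add_eq_of_eq_zero (M.dd 1 u) h0 e
  have h3 := tensorμ_contract (B' := r.b.obj (M.d 1 y)) (X' := a'.F.obj y)
    (r.b.counit (M.dd 1 u)) (a'.φ.app u)
  have h4 : (r.b.counit (M.dd 1 u) ▷ r.b.obj (M.d 1 y) ≫ (λ_ _).hom ≫ r.b.tr e ⊗ₘ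
      a'.φ.app u ▷ a'.F.obj y ≫ (λ_ _).hom) =
    ((r.b.counit (M.dd 1 u) ▷ r.b.obj (M.d 1 y) ≫ (λ_ _).hom) ⊗ₘ
      (a'.φ.app u ▷ a'.F.obj y ≫ (λ_ _).hom)) ≫ (r.b.tr e ▷ _) := by
    rw [← tensorHom_id (r.b.tr e), tensorHom_comp_tensorHom]; simp
  have h5 : (r.app (M.d 2 u) ▷ _) ≫ (((r.b.counit (M.dd 1 u) ▷ a'.F.obj (M.d 2 u)) ≫
      (λ_ _).hom ≫ a'.φ.app u) ▷ (r.b.obj (M.d 1 y) ⊗ a'.F.obj y)) = a.φ.app u ▷ _ := by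
    rw [← comp_whiskerRight, r.app_d]
  rw [← cancel_epi (a.F.add h), reassoc_of% (a.add_sh u h), ← reassoc_of% h1, ← id_tensorHom,
    tensorHom_comp_tensorHom, add_sh, Category.comp_id, h2, h4]
  refine Eq.trans ?_ (((r.app (M.d 2 u) ⊗ₘ r.app y) ≫= (h3 =≫ (r.b.tr e ▷ _))).symm.trans
    (by simp only [Category.assoc]))
  rw [MonoidalCategory.tensorHom_def', Category.assoc, Category.assoc]
  refine Eq.trans ?_ (((_ ◁ r.app y) ≫= (h5 =≫ ((λ_ _).hom ≫ (r.b.tr e ▷ _)))).symm.trans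
    (by simp only [Category.assoc]))
  rw [whisker_exchange_assoc]
  exact (_ ≫= leftUnitor_naturality_assoc (r.app y) (r.b.tr e ▷ _)).symm

/-- The naturality of `spl u` for a morphism of cocycles up to the coboundary of `b`. -/
theorem Pre.spl_app {a a' : H M A} (r : Pre a a') {u : M.X 3} {x y z : M.X 2}
    (h : M.d 2 u + (y + z) = x) (e : M.d 1 y + M.d 1 z = M.d 1 x) :
    a.spl u h ≫ (r.app y ⊗ₘ r.app z) ≫ tensorμ _ _ _ _ ≫ (r.b.add e ▷ _) =
      r.app x ≫ (_ ◁ a'.spl u h) := by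
  have h1 := r.app_add (rfl : y + z = y + z) (map_add (M.d 1) y z).symm
  have h2 := r.sh_app h ((map_add _ _ _).trans e)
  have h3 := r.b.add_tr (map_add (M.d 1) y z).symm ((map_add _ _ _).trans e)
  rw [← cancel_mono (_ ◁ a'.F.add rfl)]
  simp only [Category.assoc]
  rw [← whiskerLeft_comp, a'.spl_add, ← h2, ← a.spl_add h rfl, Category.assoc, ← reassoc_of% h1,
    ← MonoidalCategory.tensorHom_def, ← h3, ← tensorHom_id, tensorHom_comp_tensorHom,
    Category.comp_id]

/-- The isomorphism of a homotopy is natural. For a morphism represented by `(b, f)` the two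
composites have representatives that differ by the coboundary of the pullback of `b` along the
operator `-s 0`, because `d s 1 + T' 1 = -s 0 d + T 1`. -/
theorem htpy_natural {T T' : CxMap M N} (s : Htpy T T') {a a' : H N A} (f : a ⟶ a') :
    (map T).map f ≫ htpy s a' = htpy s a ≫ (map T').map f := by
  obtain ⟨r⟩ := f
  let k : M.X 1 →ₜ+ N.X 1 := (N.d 1).comp (s.s 1) + T'.T 1
  let c := r.b.pull (-(s.s 0))
  let B := (r.b.pull (N.d 1)).pull (s.s 1)
  let B' := r.b.pull (T'.T 1)
  let C := a'.F.pull (s.s 1)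
  let e : B ⊗ B' ⟶ c.pull (M.d 0) ⊗ r.b.pull (T.T 1) :=
    AddFun.pullAdd (f := (N.d 1).comp (s.s 1)) (g := T'.T 1) (k := k) (fun x => rfl) r.b ≫
      AddFun.pullSplit (f := (-(s.s 0)).comp (M.d 0)) (g := T.T 1) (k := k) (fun x => by
        rw [← s.h 0 x]
        change - s.s 0 (M.d 0 x) + _ = N.d 1 (s.s 1 x) + T'.T 1 x
        abel) r.b
  let g : a.F.pull (s.s 1) ⊗ B' ⟶ c.pull (M.d 0) ⊗ (r.b.pull (T.T 1) ⊗ C) :=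
    ((by exact AddFun.pullHom (s.s 1) r.f : a.F.pull (s.s 1) ⟶ B ⊗ C) ▷ B') ≫
      ((α_ B C B').hom ≫ (B ◁ (β_ C B').hom) ≫ (α_ B B' C).inv) ≫ (e ▷ C) ≫ (α_ _ _ _).hom
  refine (Quot.sound (r := Rel) (a := (htpyPre s a).comp (mapPre T' r))
    (b := (mapPre T r).comp (htpyPre s a')) ⟨c, by exact g, fun x => ?_⟩).symm
  have key : ∀ {u : N.X 3} {x y w : N.X 2} {n t t' k : N.X 1} (h : N.d 2 u + (w + y) = x)
      (ht : N.d 1 x = t) (ht' : N.d 1 y = t') (hk : N.d 1 w + t' = k) (hn : n = 0)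
      (hk' : n + t = k),
      (a.spl u h ≫ (𝟙 _ ⊗ₘ (r.app y ≫ (r.b.tr ht' ⊗ₘ 𝟙 _))) ≫ (α_ _ _ _).inv) ≫
        ((((r.app w ⊗ₘ 𝟙 _) ≫ ((α_ _ _ _).hom ≫ (𝟙 _ ⊗ₘ (β_ _ _).hom) ≫ (α_ _ _ _).inv) ≫
          ((r.b.add hk ≫ inv (r.b.add hk')) ⊗ₘ 𝟙 _) ≫ (α_ _ _ _).hom) ≫
            (r.b.counit hn ▷ _) ≫ (λ_ _).hom) ▷ _) =
        (r.app x ≫ (r.b.tr ht ⊗ₘ 𝟙 _)) ≫ (𝟙 _ ⊗ₘ a'.spl u h) ≫ (α_ _ _ _).inv := by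
    intro u x y w n t t' k h ht ht' hk hn hk'
    subst ht ht'
    have e : k = N.d 1 x := by rw [← hk', hn, zero_add]
    have h1 := r.spl_app h (hk.trans e)
    have h2 := r.b.inv_add_counit hn hk' e
    have h3 := r.b.add_tr hk e
    simp only [AddFun.tr_rfl, id_tensorHom, tensorHom_id, id_whiskerRight, Category.comp_id,
      Category.assoc]
    rw [← reassoc_of% h1, ← h3, ← h2]
    simp [tensorμ, MonoidalCategory.tensorHom_def']
  exact key (s.h 1 x) (T.comm 1 x).symm (T'.comm 1 x).symm rfl (by
    change - s.s 0 (M.d 0 (M.d 1 x)) = 0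
    rw [M.dd, map_zero, neg_zero]) _

end H

/-! ### Homotopies and sums -/

theorem CxMap.add_comp {S S' S'' : CxMap N P} (h : ∀ i x, S.T i x + S'.T i x = S''.T i x)
    (T : CxMap M N) (i : ℕ) (x : M.X i) :
    (S.comp T).T i x + (S'.comp T).T i x = (S''.comp T).T i x := h i (T.T i x)

theorem CxMap.comp_add {T T' T'' : CxMap M N} (h : ∀ i x, T.T i x + T'.T i x = T''.T i x)
    (S : CxMap N P) (i : ℕ) (x : M.X i) :
    (S.comp T).T i x + (S.comp T').T i x = (S.comp T'').T i x :=
  (map_add (S.T i) _ _).symm.trans (congrArg (S.T i) (h i x))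

namespace H

omit [IsGroupoid A] in
theorem tensorμ_tensorμ (a b c d : A) : tensorμ a b c d ≫ tensorμ a c b d = 𝟙 _ := by
  have h : a ◁ (β_ b c).hom ▷ d ≫ a ◁ (β_ c b).hom ▷ d = 𝟙 _ := by
    rw [← whiskerLeft_comp, ← comp_whiskerRight, SymmetricCategory.symmetry]; simp
  simp [tensorμ, reassoc_of% h]

omit [IsGroupoid A] in
/-- The coherence that makes the sum of representatives compatible with their composition. -/
theorem interchange_comp {a a' a'' e e' e'' B B' C C' : A} (p : a ⟶ B ⊗ a') (p' : e ⟶ B' ⊗ e')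
    (q : a' ⟶ C ⊗ a'') (q' : e' ⟶ C' ⊗ e'') :
    (((p ≫ (B ◁ q) ≫ (α_ B C a'').inv) ⊗ₘ (p' ≫ (B' ◁ q') ≫ (α_ B' C' e'').inv)) ≫
      tensorμ (B ⊗ C) a'' (B' ⊗ C') e'') ≫ (tensorμ B C B' C' ▷ _) =
    ((p ⊗ₘ p') ≫ tensorμ B a' B' e') ≫ (_ ◁ ((q ⊗ₘ q') ≫ tensorμ C a'' C' e'')) ≫
      (α_ _ _ _).inv := by
  have h := associator_monoidal B C a'' B' C' e''
  have h' := tensorμ_natural (𝟙 B) q (𝟙 B') q'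
  rw [id_tensorHom_id, id_tensorHom, id_tensorHom, id_tensorHom] at h'
  rw [← cancel_mono (α_ _ _ _).hom]
  simp only [Category.assoc, h, Iso.inv_hom_id, Category.comp_id, whiskerLeft_comp]
  rw [← reassoc_of% h', tensorHom_comp_tensorHom_assoc, tensorHom_comp_tensorHom_assoc]
  simp

theorem addHom_comp {a a' a'' e e' e'' : H M A} (f : a ⟶ a') (g : a' ⟶ a'') (f' : e ⟶ e')
    (g' : e' ⟶ e'') : addHom (f ≫ g) (f' ≫ g') = addHom f f' ≫ addHom g g' := by
  obtain ⟨p⟩ := f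
  obtain ⟨q⟩ := g
  obtain ⟨p'⟩ := f'
  obtain ⟨q'⟩ := g'
  refine mk_eq (p := (p.comp q).add (p'.comp q')) (q := (p.add p').comp (q.add q'))
    (tensorμ p.b q.b p'.b q'.b) fun x => ?_
  have h := interchange_comp (p.f.app x) (p'.f.app x) (q.f.app x) (q'.f.app x)
  simp only [AddFun.comp_app, AddFun.tensorHom_app, AddFun.tensorμ_app, AddFun.whiskerLeft_app,
    AddFun.associator_inv_app]
  exact h

theorem addHom_ofHom {a a' e e' : H M A} (f : a.F ⟶ a'.F) (h) (g : e.F ⟶ e'.F) (h') :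
    addHom (ofHom f h) (ofHom g h') = ofHom (a := a.add e) (a' := a'.add e') (f ⊗ₘ g) (fun x => by
      have e : (a.add e).φ.app x = (a.φ.app x ⊗ₘ e.φ.app x) ≫ (λ_ (𝟙_ A)).hom := by simp
      rw [e, ← h, ← h', ← tensorHom_comp_tensorHom]; simp) := by
  refine mk_eq (p := (Pre.ofHom f h).add (Pre.ofHom g h')) (λ_ (𝟙_ (AddFun (M.X 1) A))).hom
    fun x => ?_
  have key : ∀ {c d c' d' : A} (p : c ⟶ d) (p' : c' ⟶ d'), (((p ≫ (λ_ d).inv) ⊗ₘ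
      (p' ≫ (λ_ d').inv)) ≫ tensorμ _ _ _ _) ≫ ((λ_ (𝟙_ A)).hom ▷ _) =
        (p ⊗ₘ p') ≫ (λ_ _).inv := by
    intro c d c' d' p p'
    have h := tensorμ_unit (𝟙 (𝟙_ A)) (𝟙 _) d d'
    rw [id_tensorHom_id, Category.id_comp, id_whiskerRight, id_whiskerRight, Category.id_comp,
      Category.id_comp] at h
    rw [← cancel_mono (λ_ _).hom]
    simp only [Category.assoc, h, Iso.inv_hom_id, Category.comp_id, tensorHom_comp_tensorHom]
  have := key (f.app x) (g.app x)
  simp only [AddFun.comp_app, AddFun.tensorHom_app, AddFun.tensorμ_app, AddFun.leftUnitor_inv_app]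
  exact this

theorem map_ofHom (T : CxMap M N) {a a' : H N A} (f : a.F ⟶ a'.F) (h) :
    (map T).map (ofHom f h) = ofHom (a := (map T).obj a) (a' := (map T).obj a')
      (AddFun.pullHom (T.T 2) f) (fun x => by
      have key : ∀ {x : N.X 3} {y : N.X 2} (hy : y = N.d 2 x),
        f.app y ≫ a'.F.tr hy ≫ a'.φ.app x = a.F.tr hy ≫ a.φ.app x := by
        intro x y hy; subst hy; simp [h]
      exact key (T.comm 2 x)) := by
  refine mk_eq (p := mapPre T (Pre.ofHom f h)) (by exact 𝟙 (AddFun.unitObj)) fun x => ?_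
  have key : ∀ {x : N.X 2} {y : N.X 1} (hy : N.d 1 x = y),
      ((f.app x ≫ (λ_ _).inv) ≫ ((AddFun.unitObj : AddFun (N.X 1) A).tr hy ⊗ₘ 𝟙 _)) ≫
        (𝟙 (𝟙_ A) ▷ _) = f.app x ≫ (λ_ _).inv := by
    intro x y hy; simp
  exact key (T.comm 1 x).symm

theorem add_sh_sh (a : H M A) {u u' v : M.X 3} {x y z x' y' z' : M.X 2} (h : M.d 2 u + y = x)
    (h' : M.d 2 u' + y' = x') (h'' : M.d 2 v + z' = z) (hv : u + u' = v) (hz : x + x' = z)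
    (hz' : y + y' = z') :
    a.F.add hz ≫ a.sh v h'' = (a.sh u h ⊗ₘ a.sh u' h') ≫ a.F.add hz' := by
  have e : M.d 2 u' + z' = y + x' := by rw [← hz', ← h', add_left_comm]
  have e' : M.d 2 u + (y + x') = z := by rw [← hz, ← h, add_assoc]
  rw [← a.sh_sh e' e h'' hv, ← Category.assoc, a.add_sh' u h hz rfl e', Category.assoc,
    a.add_sh_right u' h' rfl hz' e, MonoidalCategory.tensorHom_def, Category.assoc]

theorem add_F_add (a e : H M A) {x y z : M.X 2} (h : x + y = z) :
    (a.add e).F.add h = tensorμ _ _ _ _ ≫ (a.F.add h ⊗ₘ e.F.add h) := rfl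

theorem add_φ_app (a e : H M A) (x : M.X 3) :
    (a.add e).φ.app x = (a.φ.app x ⊗ₘ e.φ.app x) ≫ (λ_ (𝟙_ A)).hom := rfl

theorem add_sh_eq (a e : H M A) {u : M.X 3} {x y : M.X 2} (h : M.d 2 u + y = x) :
    (a.add e).sh u h = a.sh u h ⊗ₘ e.sh u h := by
  rw [← cancel_epi ((a.add e).F.add h), add_sh, add_F_add, Category.assoc,
    tensorHom_comp_tensorHom, add_sh, add_sh, add_φ_app]
  erw [← tensorμ_unit (a.φ.app u) (e.φ.app u) (a.F.obj y) (e.F.obj y), reassoc_of% tensorμ_tensorμ]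
  rfl

theorem add_spl (a e : H M A) {u : M.X 3} {x y z : M.X 2} (h : M.d 2 u + (y + z) = x) :
    (a.add e).spl u h = (a.spl u h ⊗ₘ e.spl u h) ≫ tensorμ _ _ _ _ := by
  refine ((a.add e).eq_spl h _ rfl ?_).symm
  rw [add_sh_eq, add_F_add, Category.assoc]
  erw [reassoc_of% tensorμ_tensorμ]
  rw [tensorHom_comp_tensorHom, spl_add, spl_add]

theorem spl_add_spl (a : H M A) {u u' v : M.X 3} {x y z x' y' z' x'' y'' z'' : M.X 2}
    (h : M.d 2 u + (y + z) = x) (h' : M.d 2 u' + (y' + z') = x')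
    (h'' : M.d 2 v + (y'' + z'') = x'') (hv : u + u' = v) (hx : x + x' = x'') (hy : y + y' = y'')
    (hz : z + z' = z'') :
    ((a.spl u h ⊗ₘ a.spl u' h') ≫ tensorμ _ _ _ _) ≫ (a.F.add hy ⊗ₘ a.F.add hz) =
      a.F.add hx ≫ a.spl v h'' := by
  have e : y + z + (y' + z') = y'' + z'' := by rw [← hy, ← hz]; abel
  rw [← cancel_mono (a.F.add rfl), Category.assoc, Category.assoc, Category.assoc,
    ← a.F.medial rfl rfl e hy hz rfl, tensorHom_comp_tensorHom_assoc, spl_add, spl_add, spl_add,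
    a.add_sh_sh h h' h'' hv hx e]

/-- The isomorphism of a homotopy is additive in the object. -/
theorem addHom_htpy {T T' : CxMap M N} (s : Htpy T T') (a e : H N A) :
    addHom (htpy s a) (htpy s e) ≫ (mapAdd T' a e).hom =
      (mapAdd T a e).hom ≫ htpy s (a.add e) := by
  refine (mk_comp_ofHom ((htpyPre s a).add (htpyPre s e)) _ _).trans
    (Eq.trans ?_ (ofHom_comp_mk _ _ (htpyPre s (a.add e))).symm)
  refine mk_eq (by exact 𝟙 (htpyPre s (a.add e)).b) fun x => ?_
  have h := add_spl a e (s.h 1 x)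
  simp only [AddFun.comp_app, AddFun.tensorHom_app, AddFun.tensorμ_app, AddFun.whiskerLeft_app]
  refine Eq.trans ?_ (Eq.trans h.symm (Category.id_comp _).symm)
  have key : ∀ {X Y Z W : A} (f : X ⟶ Y ⊗ Z), (f ≫ (Y ◁ 𝟙 Z)) ≫ (𝟙 Y ▷ Z) = f := by
    intros; simp
  exact key (W := 𝟙_ A) _

theorem ofHom_congr {a a' : H M A} {f f' : a.F ⟶ a'.F} {h h'} (e : ∀ x, f.app x = f'.app x) :
    (ofHom f h : a ⟶ a') = ofHom f' h' := by
  obtain rfl : f = f' := AddFun.hom_ext e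
  rfl

theorem mapAdd_comp (S : CxMap N P) (T : CxMap M N) (a e : H P A) :
    (mapAdd T ((map S).obj a) ((map S).obj e)).hom ≫ (map T).map (mapAdd S a e).hom ≫
      (mapComp S T (a.add e)).hom =
    addHom (mapComp S T a).hom (mapComp S T e).hom ≫ (mapAdd (S.comp T) a e).hom := by
  simp only [mapAdd, mapComp]
  erw [map_ofHom, addHom_ofHom, ofHom_comp, ofHom_comp, ofHom_comp]
  refine ofHom_congr fun x => ?_
  exact (by simp : ∀ X Y : A, 𝟙 (X ⊗ Y) ≫ 𝟙 _ ≫ 𝟙 _ = (𝟙 X ⊗ₘ 𝟙 Y) ≫ 𝟙 _)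
    (a.F.obj (S.T 2 (T.T 2 x))) (e.F.obj (S.T 2 (T.T 2 x)))

theorem mapAdd_mapSum {S S' S'' : CxMap N P} (T : CxMap M N)
    (h : ∀ i x, S.T i x + S'.T i x = S''.T i x) (a : H P A) :
    (mapAdd T ((map S).obj a) ((map S').obj a)).hom ≫ (map T).map (mapSum h a) ≫
      (mapComp S'' T a).hom =
    addHom (mapComp S T a).hom (mapComp S' T a).hom ≫
      mapSum (CxMap.add_comp h T) a := by
  simp only [mapAdd, mapComp, mapSum]
  erw [map_ofHom, addHom_ofHom, ofHom_comp, ofHom_comp, ofHom_comp]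
  refine ofHom_congr fun x => ?_
  exact (by simp : ∀ {X Y Z : A} (f : X ⊗ Y ⟶ Z), 𝟙 (X ⊗ Y) ≫ f ≫ 𝟙 _ = (𝟙 X ⊗ₘ 𝟙 Y) ≫ f)
    (a.F.add (h 2 (T.T 2 x)))

theorem mapSum_map {T T' T'' : CxMap M N} (h : ∀ i x, T.T i x + T'.T i x = T''.T i x)
    (S : CxMap N P) (a : H P A) :
    mapSum h ((map S).obj a) ≫ (mapComp S T'' a).hom =
    addHom (mapComp S T a).hom (mapComp S T' a).hom ≫
      mapSum (CxMap.comp_add h S) a := by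
  simp only [mapComp, mapSum]
  erw [addHom_ofHom, ofHom_comp, ofHom_comp]
  refine ofHom_congr fun x => ?_
  exact (by simp : ∀ {X Y Z : A} (f : X ⊗ Y ⟶ Z), f ≫ 𝟙 _ = (𝟙 X ⊗ₘ 𝟙 Y) ≫ f)
    (a.F.add ((map_add _ _ _).symm.trans (congrArg (S.T 2) (h 2 x))))

/-- The isomorphism of a homotopy is additive in the homotopy. -/
theorem mapSum_htpy {T T' T'' U U' U'' : CxMap M N} (h : ∀ i x, T.T i x + T'.T i x = T''.T i x)
    (h' : ∀ i x, U.T i x + U'.T i x = U''.T i x) (s : Htpy T U) (s' : Htpy T' U')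
    (s'' : Htpy T'' U'') (hs : ∀ i x, s.s i x + s'.s i x = s''.s i x) (a : H N A) :
    addHom (htpy s a) (htpy s' a) ≫ mapSum h' a = mapSum h a ≫ htpy s'' a := by
  refine (mk_comp_ofHom ((htpyPre s a).add (htpyPre s' a)) _ _).trans
    (Eq.trans ?_ (ofHom_comp_mk _ _ (htpyPre s'' a)).symm)
  refine mk_eq (AddFun.pullAdd (f := s.s 1) (g := s'.s 1) (hs 1) a.F) fun x => ?_
  have key := spl_add_spl a (s.h 1 x) (s'.h 1 x) (s''.h 1 x) (hs 2 x) (h 2 x) (hs 1 (M.d 1 x))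
    (h' 2 x)
  rw [MonoidalCategory.tensorHom_def' (a.F.add _) (a.F.add _), ← id_tensorHom,
    ← Category.assoc] at key
  simp only [AddFun.comp_app, AddFun.tensorHom_app, AddFun.tensorμ_app]
  exact key

end H

/-! ### Squares that commute up to a homotopy -/

/-- Homotopies with equal operators are homotopic. -/
def Htpy2.ofEq {M N : Cx.{w}} {T T' : CxMap M N} {s s' : Htpy T T'}
    (h : ∀ i x, s.s i x = s'.s i x) : Htpy2 s s' where
  t _ := 0
  h i x := by
    rw [h]
    change N.d (i + 2) 0 + (s'.s (i + 1) x - 0) = _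
    rw [map_zero, zero_add, sub_zero]

section

variable {M N : Cx.{w}} {A : Type u} [Category.{v} A] [MonoidalCategory A] [SymmetricCategory A]
  [IsGroupoid A]

/-- The isomorphism given by a homotopy. -/
@[simps]
def H.htpyIso {T T' : CxMap M N} (s : Htpy T T') (a : H N A) :
    (H.map T).obj a ≅ (H.map T').obj a where
  hom := H.htpy s a
  inv := H.htpy s.symm a
  hom_inv_id := by
    rw [H.htpy_trans]
    exact H.htpy_self _ (fun i x => add_neg_cancel (s.s i x)) a
  inv_hom_id := by
    rw [H.htpy_trans]
    exact H.htpy_self _ (fun i x => neg_add_cancel (s.s i x)) a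

namespace H

variable {P Q : Cx.{w}} {S S' S'' : CxMap N P} {D : CxMap M N} {R : CxMap Q P}
  {C C' C'' : CxMap M Q}

/-- The isomorphism given by a homotopy that fills a square of maps of complexes. -/
def squareIso (s : Htpy (S.comp D) (R.comp C)) (a : H P A) :
    (map D).obj ((map S).obj a) ≅ (map C).obj ((map R).obj a) :=
  mapComp S D a ≪≫ htpyIso s a ≪≫ (mapComp R C a).symm

theorem squareIso_hom_mapComp (s : Htpy (S.comp D) (R.comp C)) (a : H P A) :
    (squareIso s a).hom ≫ (mapComp R C a).hom = (mapComp S D a).hom ≫ htpy s a := by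
  simp [squareIso]

theorem squareIso_natural (s : Htpy (S.comp D) (R.comp C)) {a a' : H P A} (f : a ⟶ a') :
    (map D).map ((map S).map f) ≫ (squareIso s a').hom =
      (squareIso s a).hom ≫ (map C).map ((map R).map f) := by
  have h := mapComp_natural S D f
  rw [← cancel_mono (mapComp R C a').hom, Category.assoc, Category.assoc, squareIso_hom_mapComp,
    mapComp_natural, reassoc_of% squareIso_hom_mapComp, ← htpy_natural, reassoc_of% h]

theorem squareIso_trans (s : Htpy (S.comp D) (R.comp C)) (r : Htpy C C') (a : H P A) :
    (squareIso s a).hom ≫ htpy r ((map R).obj a) =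
      (squareIso (s.trans (r.postcomp R)) a).hom := by
  rw [← cancel_mono (mapComp R C' a).hom, Category.assoc, htpy_map,
    reassoc_of% squareIso_hom_mapComp, htpy_trans, squareIso_hom_mapComp]

theorem map_htpy_squareIso (r : Htpy S S') (s : Htpy (S'.comp D) (R.comp C)) (a : H P A) :
    (map D).map (htpy r a) ≫ (squareIso s a).hom =
      (squareIso ((r.precomp D).trans s) a).hom := by
  have h := map_htpy r D a
  rw [← cancel_mono (mapComp R C a).hom, Category.assoc, squareIso_hom_mapComp,
    reassoc_of% h, htpy_trans, squareIso_hom_mapComp]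

theorem squareIso_eq {s s' : Htpy (S.comp D) (R.comp C)} (t : Htpy2 s s') (a : H P A) :
    (squareIso s a).hom = (squareIso s' a).hom := by
  rw [← cancel_mono (mapComp R C a).hom, squareIso_hom_mapComp, squareIso_hom_mapComp,
    htpy_eq _ _ t]

theorem squareIso_add (s : Htpy (S.comp D) (R.comp C)) (a e : H P A) :
    (mapAdd D ((map S).obj a) ((map S).obj e)).hom ≫ (map D).map (mapAdd S a e).hom ≫
        (squareIso s (a.add e)).hom =
      addHom (squareIso s a).hom (squareIso s e).hom ≫
        (mapAdd C ((map R).obj a) ((map R).obj e)).hom ≫ (map C).map (mapAdd R a e).hom := by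
  have h := mapAdd_comp S D a e
  rw [← cancel_mono (mapComp R C (a.add e)).hom]
  simp only [Category.assoc]
  rw [squareIso_hom_mapComp, mapAdd_comp, reassoc_of% h, ← addHom_htpy, ← Category.assoc,
    ← Category.assoc, ← addHom_comp, ← addHom_comp, squareIso_hom_mapComp, squareIso_hom_mapComp]

theorem squareIso_sum (hS : ∀ i x, S.T i x + S'.T i x = S''.T i x)
    (hC : ∀ i x, C.T i x + C'.T i x = C''.T i x) (s : Htpy (S.comp D) (R.comp C))
    (s' : Htpy (S'.comp D) (R.comp C')) (s'' : Htpy (S''.comp D) (R.comp C''))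
    (hs : ∀ i x, s.s i x + s'.s i x = s''.s i x) (a : H P A) :
    (mapAdd D ((map S).obj a) ((map S').obj a)).hom ≫ (map D).map (mapSum hS a) ≫
        (squareIso s'' a).hom =
      addHom (squareIso s a).hom (squareIso s' a).hom ≫ mapSum hC ((map R).obj a) := by
  have h := mapAdd_mapSum D hS a
  rw [← cancel_mono (mapComp R C'' a).hom]
  simp only [Category.assoc]
  rw [squareIso_hom_mapComp, mapSum_map, reassoc_of% h, ← mapSum_htpy _ _ s s' s'' hs,
    ← Category.assoc, ← Category.assoc, ← addHom_comp, ← addHom_comp, squareIso_hom_mapComp,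
    squareIso_hom_mapComp]

end H

end

/-! ### The cap product and the connecting map -/

variable {X : SSet.{w}} {Y : X.Subcomplex}

theorem cap_congr {p q m : ℤ} (h : q + m = p) (z : K X p) {Y' : X.Subcomplex} {g : L Y m}
    {g' : L Y' m} (e : g.1 = g'.1) : cap h z g = cap h z g' := by
  ext1 hq
  rw [cap_val _ hq, cap_val _ hq, e]

/-- The connecting operator differs from the coboundary of the extension by zero by a cochain
supported in `Y`; here the cap product takes all of them as cochains of `X`. -/
theorem cap_del {p q a b : ℤ} (h : q + b = p) (ha : a + 1 = b) (z : K X p)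
    (g : L (⊥ : Y.toSSet.Subcomplex) a) :
    cap h z (del ha g) + cap h z (extL b (δ ⊥ ha g)) = cap h z (δ ⊥ ha (extL a g)) := by
  let g' : L (⊥ : X.Subcomplex) b :=
    ⟨(del ha g).1, fun x hx => (del ha g).2 x (hx.imp_right False.elim)⟩
  rw [show cap h z (del ha g) = cap h z g' from cap_congr h z rfl, ← map_add]
  congr 1
  ext x hx
  exact del_add ha g x

/-- The projection formula for the inclusion of `Y`: a chain of `Y` may be capped with the extension
by zero. -/
theorem inclK_cap {p q m : ℤ} (h : q + m = p) (z : K Y.toSSet p)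
    (g : L (⊥ : Y.toSSet.Subcomplex) m) :
    inclK Y q (cap h z g) = cap h (inclK Y p z) (extL m g) := by
  ext1 hq
  rw [inclK_val, cap_val _ hq, cap_val _ hq, inclK_val, Finsupp.mapDomain_smul]
  congr 1
  generalize z.1 = z
  induction z using Finsupp.induction_linear with
  | zero => simp
  | add x y hx hy => simp_all [Finsupp.mapDomain_add]
  | single x r =>
    rw [cap₀_single, Finsupp.mapDomain_single, Finsupp.mapDomain_single, cap₀_single,
      extL_pos g (mem_act _ (incl_mem Y x))]
    rfl

theorem sgn_apply {M N : Type w} [AddCommGroup M] [TopologicalSpace M] [AddCommGroup N]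
    [TopologicalSpace N] [IsTopologicalAddGroup N] (n : ℤ) (f : M →ₜ+ N) (x : M) :
    sgn n f x = (n.negOnePow : ℤ) • f x := rfl

/-- The operators `± z ∩ (extension by zero)` satisfy the equation of a homotopy, by the boundary
formula for `z ∩ (extension by zero)`. The signs enter only through their parities, and `b = b'` are
separate because they are given by different expressions. -/
theorem conn_htpy {n p k k' a b b' : ℤ} (τ τ₁ τ₂ σ σ' j : ℤ) (hσ : σ = τ + 1) (hσ' : σ' = τ + n + 1)
    (hτ : τ₁ + τ₂ = τ + 2 * j) (hp : n + 1 = p) (ha : a + 1 = b) (hk : k + 1 = k')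
    (ha' : a + 1 = b') (h : k + a = n) (h₁ : k + b = p) (h₁' : k + b' = p) (h₂ : k' + a = p)
    {z : K X p} {w : K Y.toSSet n}
    (hw : inclK Y n w = d hp z) (g : L (⊥ : Y.toSSet.Subcomplex) a) :
    d hk (sgn σ' ((cap h₂ z).comp (extL a)) g) +
      (sgn σ ((cap h₁ z).comp (extL b)) (δ ⊥ ha g) + inclK Y k (sgn τ (cap h w) g)) =
    sgn τ₁ (cap h₁' z) (sgn τ₂ (del ha') g) := by
  obtain rfl : b = b' := ha.symm.trans ha'
  have e := cap_del h₁ ha z g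
  rw [cap_δ ha hp hk h₁ h h₂, ← hw, ← inclK_cap, ← eq_sub_iff_add_eq] at e
  have e1 : (τ.negOnePow : ℤ) = τ₁.negOnePow * τ₂.negOnePow := by
    rw [← Units.val_mul, ← Int.negOnePow_add, hτ, Int.negOnePow_add, Int.negOnePow_two_mul]
    simp
  simp only [sgn_apply, map_zsmul, e]
  change (σ'.negOnePow : ℤ) • d hk (cap h₂ z (extL a g)) + ((σ.negOnePow : ℤ) •
    cap h₁ z (extL b (δ ⊥ ha g)) + _) = _
  subst hσ hσ' hp
  rw [smul_smul, mul_comm, ← e1, Int.negOnePow_succ, Int.negOnePow_succ, Int.negOnePow_add,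
    Int.negOnePow_succ]
  simp only [Units.val_mul, Units.val_neg, neg_smul, smul_add, smul_sub, smul_neg, smul_smul]
  abel

/-- The homotopy between `g ↦ z ∩ del g` and `g ↦ w ∩ g`, for a cycle `w` of `Y` that is the boundary
of the relative cycle `z`. -/
def connHtpy {n q m : ℤ} (h : q + m = n) (h' : q + (m + 1) = n + 1) (z : IntHomology Y (n + 1))
    (w : IntHomology (⊥ : Y.toSSet.Subcomplex) n) (hw : inclK Y n w.z = d rfl z.z) :
    Htpy ((capMap h' z.z z.hz).comp (delMap Y m)) ((resMap Y q).comp (capMap h w.z w.hz)) where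
  s i := sgn (n * (i + 1) + 1) ((cap (by rw [← h]; push_cast; ring) z.z).comp (extL _))
  h i x := by
    refine conn_htpy (n * (i + 1 : ℕ)) ((n + 1) * (i + 1 : ℕ)) (i + 1 : ℕ) (n * (i + 1) + 1)
      (n * ((i + 1 : ℕ) + 1) + 1) (i + 1 : ℕ) ?_ ?_ ?_ rfl ?_ ?_ ?_ ?_ ?_ ?_ ?_ hw x <;> push_cast <;>
      (try rw [← h]) <;> ring

/-- The boundary formula for `v ∩ (extension by zero)`, with the signs of a homotopy between
homotopies. -/
theorem conn_htpy2 {n p p' k k' a b b' : ℤ} (τ τ₁ τ₂ σ σ' j : ℤ) (hσ : σ = τ + 1)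
    (hσ' : σ' = τ + n + 1) (hτ : τ₁ + τ₂ = τ + 1 + 2 * j) (hn : n + 1 = p) (hp : p + 1 = p')
    (ha : a + 1 = b)
    (hk : k + 1 = k') (ha' : a + 1 = b') (h : k + a = p) (h₁ : k + b = p')
    (h₁' : k + b' = p') (h₂ : k' + a = p') {z z' : K X p}
    {v : K X p'} {w : K Y.toSSet p} (hw : inclK Y p w = z - z' - d hp v)
    (g : L (⊥ : Y.toSSet.Subcomplex) a) :
    d hk (sgn σ' ((cap h₂ v).comp (extL a)) g) +
      ((sgn σ ((cap h z).comp (extL a)) g + inclK Y k (sgn τ (cap h w) g)) -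
        sgn σ ((cap h₁ v).comp (extL b)) (δ ⊥ ha g)) =
    sgn τ₁ (cap h₁' v) (sgn τ₂ (del ha') g) + sgn σ ((cap h z').comp (extL a)) g := by
  obtain rfl : b = b' := ha.symm.trans ha'
  have e := cap_del h₁ ha v g
  rw [cap_δ ha hp hk h₁ h h₂, ← eq_sub_iff_add_eq] at e
  have e1 : (τ.negOnePow : ℤ) = -(τ₁.negOnePow * τ₂.negOnePow) := by
    rw [← Units.val_mul, ← Int.negOnePow_add, hτ, Int.negOnePow_add, Int.negOnePow_two_mul,
      Int.negOnePow_succ]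
    simp
  simp only [sgn_apply, map_zsmul, inclK_cap, hw, cap_sub, e]
  change (σ'.negOnePow : ℤ) • d hk (cap h₂ v (extL a g)) + (((σ.negOnePow : ℤ) •
    cap h z (extL a g) + _) - (σ.negOnePow : ℤ) • cap h₁ v (extL b (δ ⊥ ha g))) =
      _ + (σ.negOnePow : ℤ) • cap h z' (extL a g)
  subst hσ hσ' hn hp
  rw [smul_smul, mul_comm, ← neg_eq_iff_eq_neg.2 e1]
  simp only [Int.negOnePow_add, Int.negOnePow_one, Units.val_mul, Units.val_neg,
    mul_neg, mul_one, neg_neg, neg_mul, neg_smul, smul_add, smul_sub, smul_smul]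
  abel

/-- The homotopies `connHtpy` are compatible with the morphisms of relative cycles: for a relative
homology `v` from `z` to `z'` the operators `± v ∩ (extension by zero)` are a homotopy between the two
ways from `z ∩ del` to the cap product with the boundary of `z'`. -/
def connHtpy2 {n q m : ℤ} (h : q + m = n) (h' : q + (m + 1) = n + 1) {z z' : IntHomology Y (n + 1)}
    {w w' : IntHomology (⊥ : Y.toSSet.Subcomplex) n} (hw : inclK Y n w.z = d rfl z.z)
    (hw' : inclK Y n w'.z = d rfl z'.z) (v : IntHomology.Pre z z') (y : IntHomology.Pre w w')
    (hy : inclK Y (n + 1) y.v = z.z - z'.z - d rfl v.v) :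
    Htpy2 (((capHtpy h' z.hz z'.hz v.hv).precomp (delMap Y m)).trans (connHtpy h h' z' w' hw'))
      ((connHtpy h h' z w hw).trans ((capHtpy h w.hz w'.hz y.hv).postcomp (resMap Y q))) where
  t i := sgn (n * (i + 2) + 1) ((cap (by rw [← h]; push_cast; ring) v.v).comp (extL _))
  h i x := by
    refine conn_htpy2 (n * ((i + 1 : ℕ) + 1)) ((n + 1) * ((i + 1 : ℕ) + 1)) (i + 1 : ℕ)
      (n * (i + 2) + 1) (n * ((i + 1 : ℕ) + 2) + 1) (i + 1 : ℕ) ?_ ?_ ?_ rfl rfl ?_ ?_ ?_ ?_ ?_ ?_ ?_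
      hy x <;> push_cast <;> (try rw [← h]) <;> ring


section

variable (A : Type u) [Category.{v} A] [MonoidalCategory A] [SymmetricCategory A] [IsGroupoid A]
variable {n q m : ℤ} (h : q + m = n) (h' : q + (m + 1) = n + 1)

theorem inclK_bdry (z : IntHomology Y (n + 1)) : inclK Y n ((bdry n).obj z).z = d rfl z.z :=
  inclK_resK (z.hz n rfl)

/-- The isomorphism `∂(z ∩ F) ≅ w ∩ (i^* F)` for a cycle `w` of `Y` that is the boundary of the
relative cycle `z`. -/
def connCapIso (z : IntHomology Y (n + 1)) (w : IntHomology (⊥ : Y.toSSet.Subcomplex) n)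
    (hw : inclK Y n w.z = d rfl z.z) (F : Cohomology X A q) :
    (conn A Y m).obj ((capProd A h' z).obj F) ≅ (capProd A h w).obj ((restr A Y q).obj F) :=
  H.squareIso (connHtpy h h' z w hw) F

theorem connCapIso_natural_left {z z' : IntHomology Y (n + 1)} (f : z ⟶ z')
    (F : Cohomology X A q) :
    (conn A Y m).map (capProdMapLeft h' f F) ≫ (connCapIso A h h' z' _ (inclK_bdry z') F).hom =
      (connCapIso A h h' z _ (inclK_bdry z) F).hom ≫
        capProdMapLeft h ((bdry n).map f) ((restr A Y q).obj F) := by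
  obtain ⟨v⟩ := f
  refine (H.map_htpy_squareIso _ _ F).trans (Eq.trans ?_ (H.squareIso_trans _ _ F).symm)
  refine H.squareIso_eq (connHtpy2 h h' (inclK_bdry z) (inclK_bdry z') v _ ?_) F
  exact inclK_resK v.hv

theorem inclK_sgn_cap_zero {p q m : ℤ} (k : q + m = p) (τ : ℤ) {y : K Y.toSSet p} (hy : y = 0)
    (g : L (⊥ : Y.toSSet.Subcomplex) m) : inclK Y q (sgn τ (cap k y) g) = 0 := by
  have e : cap k y g = 0 := cap_supp k (by rw [hy]; exact zero_mem _) g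
  rw [sgn_apply, e, smul_zero, map_zero]

/-- Replacing the representative of the boundary by an equal one does not change the homotopy. -/
def connHtpyEq (z : IntHomology Y (n + 1)) {w w' : IntHomology (⊥ : Y.toSSet.Subcomplex) n}
    (hw : inclK Y n w.z = d rfl z.z) (hw' : inclK Y n w'.z = d rfl z.z) (y : IntHomology.Pre w w')
    (hy : y.v = 0) :
    Htpy2 ((connHtpy h h' z w hw).trans ((capHtpy h w.hz w'.hz y.hv).postcomp (resMap Y q)))
      (connHtpy h h' z w' hw') :=
  Htpy2.ofEq fun i x => (congrArg ((connHtpy h h' z w hw).s i x + ·)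
    (inclK_sgn_cap_zero _ _ hy x)).trans (add_zero _)

theorem connHtpy_add (z z' : IntHomology Y (n + 1)) {w w' : IntHomology (⊥ : Y.toSSet.Subcomplex) n}
    (hw : inclK Y n w.z = d rfl z.z) (hw' : inclK Y n w'.z = d rfl z'.z)
    (hw'' : inclK Y n (w.add w').z = d rfl (z.add z').z) (i : ℕ)
    (x : (cochainCx (⊥ : Y.toSSet.Subcomplex) m).X i) :
    (connHtpy h h' z w hw).s i x + (connHtpy h h' z' w' hw').s i x =
      (connHtpy h h' (z.add z') (w.add w') hw'').s i x :=
  (smul_add _ _ _).symm.trans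
    (congrArg _ (cap_add (by rw [← h]; push_cast; ring) z.z z'.z (extL _ x)).symm)

theorem inclK_bdry_add (z z' : IntHomology Y (n + 1)) :
    inclK Y n (((bdry n).obj z).add ((bdry n).obj z')).z = d rfl (z.add z').z := by
  change inclK Y n (((bdry n).obj z).z + ((bdry n).obj z').z) = d rfl (z.z + z'.z)
  rw [map_add, map_add, inclK_bdry, inclK_bdry]

/-- The boundary of `z + z'` and the sum of the boundaries are equal chains, joined by the zero chain
in `bdryAdd`, so the two isomorphisms for `z + z'` differ by the cap product with `bdryAdd`. -/
theorem connCapIso_add (z z' : IntHomology Y (n + 1)) (F : Cohomology X A q) :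
    (connCapIso A h h' (z.add z') _ (inclK_bdry (z.add z')) F).hom =
      (connCapIso A h h' (z.add z') _ (inclK_bdry_add z z') F).hom ≫
        capProdMapLeft h (bdryAdd n z z') ((restr A Y q).obj F) :=
  Eq.trans (H.squareIso_eq (connHtpyEq h h' (z.add z') (inclK_bdry_add z z') _ ⟨0, _⟩ rfl) F).symm
    (H.squareIso_trans _ _ F).symm

theorem capMap_add {p q m : ℤ} (h : q + m = p) (z z' : IntHomology Y p) (i : ℕ)
    (x : (cochainCx Y m).X i) :
    (capMap h z.z z.hz).T i x + (capMap h z'.z z'.hz).T i x =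
      (capMap h (z.add z').z (z.add z').hz).T i x :=
  (smul_add _ _ _).symm.trans
    (congrArg _ (cap_add (by rw [← h]; ring) z.z z'.z x).symm)

theorem capProdAddLeft_square (z z' : IntHomology Y (n + 1)) (F : Cohomology X A q) :
    connAdd A Y m _ _ ≫ (conn A Y m).map (capProdAddLeft h' z z' F) ≫
        (connCapIso A h h' (z.add z') _ (inclK_bdry_add z z') F).hom =
      H.addHom (connCapIso A h h' z _ (inclK_bdry z) F).hom
          (connCapIso A h h' z' _ (inclK_bdry z') F).hom ≫
        capProdAddLeft h ((bdry n).obj z) ((bdry n).obj z') ((restr A Y q).obj F) :=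
  H.squareIso_sum (capMap_add h' z z') (capMap_add h ((bdry n).obj z) ((bdry n).obj z')) _ _ _
    (connHtpy_add h h' z z' (inclK_bdry z) (inclK_bdry z') (inclK_bdry_add z z')) F

theorem connCapIso_add_left (z z' : IntHomology Y (n + 1)) (F : Cohomology X A q) :
    connAdd A Y m _ _ ≫ (conn A Y m).map (capProdAddLeft h' z z' F) ≫
        (connCapIso A h h' (z.add z') _ (inclK_bdry (z.add z')) F).hom =
      H.addHom (connCapIso A h h' z _ (inclK_bdry z) F).hom
          (connCapIso A h h' z' _ (inclK_bdry z') F).hom ≫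
        capProdAddLeft h ((bdry n).obj z) ((bdry n).obj z') _ ≫
          capProdMapLeft h (bdryAdd n z z') ((restr A Y q).obj F) := by
  rw [connCapIso_add]
  have e := capProdAddLeft_square A h h' z z' F =≫
    capProdMapLeft h (bdryAdd n z z') ((restr A Y q).obj F)
  simpa only [Category.assoc] using e

end

end

end PicCoh

theorem proposition2 {X : SSet.{w}} (Y : X.Subcomplex)
    (A : Type u) [Category.{v} A] [MonoidalCategory A] [SymmetricCategory A] [IsStrictPicard A]
    (n q m : ℤ) (hq : 0 ≤ q) (hm : 0 ≤ m) (h : q + m = n) (h' : q + (m + 1) = n + 1) :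
    ∃ θ : ∀ (z : IntHomology Y (n + 1)) (F : Cohomology X A q),
        (conn A Y m).obj ((capProd A h' z).obj F) ≅
          (capProd A h ((bdry n).obj z)).obj ((restr A Y q).obj F),
      (∀ (z : IntHomology Y (n + 1)) {F F' : Cohomology X A q} (f : F ⟶ F'),
        (conn A Y m).map ((capProd A h' z).map f) ≫ (θ z F').hom =
          (θ z F).hom ≫ (capProd A h ((bdry n).obj z)).map ((restr A Y q).map f)) ∧
      (∀ {z z' : IntHomology Y (n + 1)} (f : z ⟶ z') (F : Cohomology X A q),
        (conn A Y m).map (capProdMapLeft h' f F) ≫ (θ z' F).hom =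
          (θ z F).hom ≫ capProdMapLeft h ((bdry n).map f) ((restr A Y q).obj F)) ∧
      (∀ (z : IntHomology Y (n + 1)) (F F' : Cohomology X A q),
        connAdd A Y m _ _ ≫ (conn A Y m).map (capProdAddRight A h' z F F') ≫
            (θ z (H.add F F')).hom =
          H.addHom (θ z F).hom (θ z F').hom ≫ capProdAddRight A h ((bdry n).obj z) _ _ ≫
            (capProd A h ((bdry n).obj z)).map (restrAdd A Y q F F')) ∧
      (∀ (z z' : IntHomology Y (n + 1)) (F : Cohomology X A q),
        connAdd A Y m _ _ ≫ (conn A Y m).map (capProdAddLeft h' z z' F) ≫ (θ (z.add z') F).hom =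
          H.addHom (θ z F).hom (θ z' F).hom ≫
            capProdAddLeft h ((bdry n).obj z) ((bdry n).obj z') _ ≫
              capProdMapLeft h (bdryAdd n z z') ((restr A Y q).obj F)) :=
  ⟨fun z F => connCapIso A h h' z _ (inclK_bdry z) F, fun z _ _ f => H.squareIso_natural _ f,
    fun f F => connCapIso_natural_left A h h' f F,
    fun z F F' => H.squareIso_add _ F F',
    connCapIso_add_left A h h'⟩
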